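/- Let $(\mathsf S_t)_{t\ge 0}$ be the standard Gamma process on a probability space: $\mathsf S_0=0$ a.s., independent increments, $\mathsf S_t-\mathsf S_s$ has the Gamma distribution with shape $t-s$ and rate $1$ for $0\le s<t$, and almost all paths are increasing and right-continuous. For a function $f$ on $[0,\infty)$ put $$\mathsf S_tf=\int_{(0,t]}f\,d\mathsf S\ \ \text{(pathwise)},\qquad \lambda_tf=\int_0^tf(x)\,dx,\qquad R_t(f)=\frac{\mathsf S_tf}{\lambda_tf}.$$ Fix a mode of convergence: either $L^r$ with $0\le r<\infty$ (where $L^0$ means convergence in probability) or almost sure convergence. We say that $f$ satisfies orderly divergence (OD) in this mode if $R_t(f)\to1$ in this mode as $t\to\infty$. Let $f:[0,\infty)\to[0,\infty)$ be monotonic (increasing or decreasing) with $\lambda_tf\to\infty$ as $t\to\infty$. Let $p\ge0$, $q>0$ be arbitrary and put $t_n=p+qn$ for $n=0,1,2,\dots$. Then, in the fixed mode: 1. The following are equivalent: (a) $f$ satisfies OD; (b) $R_{t_n}(f)\to1$ as $n\to\infty$; (c) the weighted law of large numbers for the discretization of $f$ along $(t_n)$ holds, that is, $$\frac{\sum_{k=1}^n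 f(t_k)\,X_k}{q\sum_{k=1}^n f(t_k)}\to 1\quad(n\to\infty),\qquad X_k=\mathsf S_{t_k}-\mathsf S_{t_{k-1}},$$ where the $X_k$ are i.i.d. Gamma variables with shape and mean $q$. In particular (b) and (c) hold either for all arithmetic sequences $(t_n)$ or for none. 2. Let $g:[0,\infty)\to\mathbb R$ be a measure-preserving rearrangement of $f$ between the nodes $t_n$; that is, on $(0,t_0]$ and on each interval $(t_k,t_{k+1}]$, $k\ge0$, the functions $g$ and $f$ are Lebesgue measurable and equimeasurable (the image of Lebesgue measure on the interval is the same under both). Then $g$ satisfies OD if and only if $f$ does. -/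

import Mathlib

open MeasureTheory ProbabilityTheory Filter Topology Set
open scoped NNReal ENNReal

noncomputable section

/-- `S` is a standard Gamma process on `[0, ∞)`, that is, the Lévy subordinator for which
`S 1` is exponential with mean `1`: it starts at `0`, has independent increments, `S t - S s` has
the Gamma distribution with shape `t - s` and rate `1` for `s < t`, and almost all paths are
increasing and right-continuous. -/
structure IsGammaProcess {Ω : Type*} [MeasurableSpace Ω] (S : ℝ≥0 → Ω → ℝ) (P : Measure Ω) :
    Prop where
  start_zero : ∀ᵐ ω ∂P, S 0 ω = 0
  indep_increments : HasIndepIncrements S P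
  law_increment : ∀ s t : ℝ≥0, s < t →
    HasLaw (fun ω => S t ω - S s ω) (gammaMeasure ((t : ℝ) - (s : ℝ)) 1) P
  monotone_path : ∀ᵐ ω ∂P, Monotone fun t => S t ω
  right_continuous_path : ∀ᵐ ω ∂P, ∀ t, ContinuousWithinAt (fun u => S u ω) (Ici t) t

open scoped Classical in
/-- The Lebesgue–Stieltjes measure `dX` on `[0, ∞)` of a path `X`, with `dX (s, t] = X t - X s`
(and the value `0` for paths that fail to be increasing and right-continuous; such paths form a
null set for a Gamma process). -/
def pathMeasure (X : ℝ≥0 → ℝ) : Measure ℝ≥0 :=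
  if h : Monotone X ∧ ∀ t, ContinuousWithinAt X (Ici t) t then
    (StieltjesFunction.mk X h.1 h.2).measure
  else 0

/-- Lebesgue measure on `[0, ∞)`. -/
def lebesgue : Measure ℝ≥0 := Measure.comap ((↑) : ℝ≥0 → ℝ) volume

variable {Ω : Type*}

/-- The pathwise Gamma integral `S_t f = ∫_0^t f dS`. -/
def gammaIntegral (S : ℝ≥0 → Ω → ℝ) (f : ℝ≥0 → ℝ) (t : ℝ≥0) (ω : Ω) : ℝ :=
  ∫ x in Ioc 0 t, f x ∂(pathMeasure fun u => S u ω)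

/-- `λ_t f = ∫_0^t f(x) dx`. -/
def cumul (f : ℝ≥0 → ℝ) (t : ℝ≥0) : ℝ :=
  ∫ x in Ioc 0 t, f x ∂lebesgue

/-- `R_t = S_t f / λ_t f`. -/
def gammaRatio (S : ℝ≥0 → Ω → ℝ) (f : ℝ≥0 → ℝ) (t : ℝ≥0) (ω : Ω) : ℝ :=
  gammaIntegral S f t ω / cumul f t

/-- The modes of convergence: `L^0` (in probability), `L^r` for `0 < r < ∞`, almost sure. -/
inductive ConvMode where
  | inProbability : ConvMode
  | inLp (r : ℝ≥0) (hr : 0 < r) : ConvMode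
  | almostSure : ConvMode

/-- The random variables `R i` converge to the constant `1` along the filter `l`, in the given
mode. -/
def ConvMode.TendstoOne [MeasurableSpace Ω] (m : ConvMode) (P : Measure Ω) {ι : Type*}
    (R : ι → Ω → ℝ) (l : Filter ι) : Prop :=
  match m with
  | .inProbability => TendstoInMeasure P R l fun _ => 1
  | .inLp r _ => Tendsto (fun i => eLpNorm (fun ω => R i ω - 1) (r : ℝ≥0∞) P) l (𝓝 0)
  | .almostSure => ∀ᵐ ω ∂P, Tendsto (fun i => R i ω) l (𝓝 1)

/-- Orderly divergence of `f` in the mode `m`: `R_t → 1` as `t → ∞`. -/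
def OrderlyDivergence [MeasurableSpace Ω] (m : ConvMode) (P : Measure Ω) (S : ℝ≥0 → Ω → ℝ)
    (f : ℝ≥0 → ℝ) : Prop :=
  m.TendstoOne P (gammaRatio S f) atTop

/-- The arithmetic sequence of nodes `t_n = p + q n`. -/
def node (p q : ℝ≥0) (n : ℕ) : ℝ≥0 := p + q * n

/-- Orderly divergence of `f` along the nodes: `R_{t_n} → 1` as `n → ∞`. -/
def OrderlyDivergenceAlong [MeasurableSpace Ω] (m : ConvMode) (P : Measure Ω)
    (S : ℝ≥0 → Ω → ℝ) (f : ℝ≥0 → ℝ) (p q : ℝ≥0) : Prop :=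
  m.TendstoOne P (fun n : ℕ => gammaRatio S f (node p q n)) atTop

/-- The normalized weighted sum `∑_{k=1}^n w_k X_k / ∑_{k=1}^n w_k E X_k` with weights
`w_k = f (t_k)` and the i.i.d. variables `X_k = S_{t_k} - S_{t_{k-1}}`, whose law is the Gamma
distribution with shape (and mean) `q`. -/
def discreteRatio (S : ℝ≥0 → Ω → ℝ) (f : ℝ≥0 → ℝ) (p q : ℝ≥0) (n : ℕ) (ω : Ω) : ℝ :=
  (∑ k ∈ Finset.Icc 1 n, f (node p q k) * (S (node p q k) ω - S (node p q (k - 1)) ω)) /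
    ∑ k ∈ Finset.Icc 1 n, f (node p q k) * (q : ℝ)

/-- The weighted law of large numbers, in the mode `m`, for the discretization of `f` along the
nodes `t_n = p + q n`. -/
def DiscreteOrderlyDivergence [MeasurableSpace Ω] (m : ConvMode) (P : Measure Ω)
    (S : ℝ≥0 → Ω → ℝ) (f : ℝ≥0 → ℝ) (p q : ℝ≥0) : Prop :=
  m.TendstoOne P (discreteRatio S f p q) atTop

/-- `g` is a measure-preserving rearrangement of `f` between the nodes `t_n = p + q n`: on the
initial interval `(0, t_0]` and on each interval `(t_k, t_{k+1}]`, the functions `g` and `f` are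
equimeasurable with respect to Lebesgue measure. -/
def IsRearrangementBetweenNodes (g f : ℝ≥0 → ℝ) (p q : ℝ≥0) : Prop :=
  IdentDistrib g f (lebesgue.restrict (Ioc 0 (node p q 0)))
    (lebesgue.restrict (Ioc 0 (node p q 0))) ∧
  ∀ k : ℕ, IdentDistrib g f (lebesgue.restrict (Ioc (node p q k) (node p q (k + 1))))
    (lebesgue.restrict (Ioc (node p q k) (node p q (k + 1))))

end

/-! Everything rests on the Laplace functional `IsRegularGammaProcess.laplace`: for integrable `k`
with nonnegative real part, `E exp(-∫ k dS) = exp(-∫ log(1 + k) dx)`. It is used in two ways.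

For real `k = h / λ_{t_n} h`, convergence `R_{t_n} → 1` in probability, the weakest of the modes,
forces `∫ (u - log(1 + u)) → 0` with `u = h / λ_{t_n} h`. Since `u ≤ δ + C_δ (u - log(1 + u))`, the
last interval, of length `q`, carries a vanishing share of the mass (`tendsto_increment_div`), so
consecutive normalizers are asymptotically equal. As `S_t h` and `λ_t h` increase in `t`,
convergence along the nodes then gives convergence along all `t` (`orderlyDivergence_iff_along`);
this needs only `h ≥ 0`, not monotonicity.

For imaginary `k` it yields characteristic functions: the joint law of the integrals over successive
intervals depends only on the distribution of the integrand on each of them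
(`identDistrib_increments`). Each mode depends only on the law of the sequence
(`Null.of_identDistrib`), so a rearrangement between nodes changes nothing along the nodes.

For the discretization, monotonicity of `f` traps `S_{t_{n+1}} f`, up to a fixed variable, between
`∑ f(t_k) X_k` and `∑ f(t_k) X_{k+1}`. These differ as random variables but have the same law as
sequences. The positive and the negative part of the deviation are treated separately: each
one-sided bound passes from one sum to the other through the equality of laws, and together they
close the squeeze. The normalizers agree asymptotically because the last weight is negligible, which
either side of the equivalence implies. -/

/-! ### The Gamma distribution: mean, Laplace transform, moments. -/

lemma lintegral_ofReal_gammaMeasure {a : ℝ} (ha : 0 < a) :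
    ∫⁻ x, ENNReal.ofReal x ∂(gammaMeasure a 1) = ENNReal.ofReal a := by
  rw [gammaMeasure, lintegral_withDensity_eq_lintegral_mul₀
    (by unfold gammaPDF; fun_prop) (by fun_prop)]
  -- Multiplication by `x` raises the shape by one; the constant is `Γ(a + 1) / Γ(a) = a`.
  have h : ∀ x, (gammaPDF a 1 * fun x => ENNReal.ofReal x) x
      = ENNReal.ofReal a * gammaPDF (a + 1) 1 x := by
    intro x
    rw [Pi.mul_apply]
    rcases lt_or_ge x 0 with hx | hx
    · simp [gammaPDF_of_neg hx]
    · rw [gammaPDF_of_nonneg hx, gammaPDF_of_nonneg hx, ← ENNReal.ofReal_mul ha.le,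
        ← ENNReal.ofReal_mul (by have := Real.Gamma_pos_of_pos ha; positivity)]
      congr 1
      rw [Real.Gamma_add_one ha.ne', Real.one_rpow, Real.one_rpow, add_sub_cancel_right]
      have := Real.Gamma_pos_of_pos ha
      rcases hx.eq_or_lt with rfl | hx
      · rw [Real.zero_rpow ha.ne']; simp
      · rw [Real.rpow_sub_one hx.ne']
        field_simp
  rw [lintegral_congr h, lintegral_const_mul _ (by unfold gammaPDF; fun_prop),
    lintegral_gammaPDF_eq_one (by linarith) one_pos, mul_one]

/-- Exponential tilting turns the rate `1` into `1 - t`, up to the normalizing constant. -/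
lemma integrable_exp_gammaMeasure {a t : ℝ} (ha : 0 < a) (ht : t < 1) :
    Integrable (fun x => Real.exp (t * x)) (gammaMeasure a 1) ∧
      ∫ x, Real.exp (t * x) ∂(gammaMeasure a 1) = (1 / (1 - t)) ^ a := by
  have h1 : 0 < 1 - t := by linarith
  have hl : ∫⁻ x, ENNReal.ofReal (Real.exp (t * x)) ∂(gammaMeasure a 1)
      = ENNReal.ofReal ((1 / (1 - t)) ^ a) := by
    rw [gammaMeasure, lintegral_withDensity_eq_lintegral_mul₀
      (by unfold gammaPDF; fun_prop) (by fun_prop)]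
    have h : ∀ x, (gammaPDF a 1 * fun x => ENNReal.ofReal (Real.exp (t * x))) x
        = ENNReal.ofReal ((1 / (1 - t)) ^ a) * gammaPDF a (1 - t) x := by
      intro x
      rw [Pi.mul_apply]
      rcases lt_or_ge x 0 with hx | hx
      · simp [gammaPDF_of_neg hx]
      · have := Real.Gamma_pos_of_pos ha
        rw [gammaPDF_of_nonneg hx, gammaPDF_of_nonneg hx, ← ENNReal.ofReal_mul (by positivity),
          ← ENNReal.ofReal_mul (by positivity)]
        congr 1
        rw [Real.one_rpow, Real.div_rpow zero_le_one h1.le, Real.one_rpow,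
          show -((1 - t) * x) = -(1 * x) + t * x by ring, Real.exp_add]
        have : (1 - t) ^ a ≠ 0 := (Real.rpow_pos_of_pos h1 a).ne'
        field_simp
    rw [lintegral_congr h, lintegral_const_mul _ (by unfold gammaPDF; fun_prop),
      lintegral_gammaPDF_eq_one ha h1, mul_one]
  have hm : AEStronglyMeasurable (fun x => Real.exp (t * x)) (gammaMeasure a 1) := by fun_prop
  constructor
  · refine ⟨hm, ?_⟩
    rw [hasFiniteIntegral_iff_ofReal (ae_of_all _ fun x => (Real.exp_pos _).le), hl]
    exact ENNReal.ofReal_lt_top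
  · rw [integral_eq_lintegral_of_nonneg_ae (ae_of_all _ fun x => (Real.exp_pos _).le) hm, hl,
      ENNReal.toReal_ofReal (by positivity)]

lemma Iio_one_subset_integrableExpSet_gammaMeasure {a : ℝ} (ha : 0 < a) :
    Iio (1 : ℝ) ⊆ interior (integrableExpSet id (gammaMeasure a 1)) :=
  interior_maximal (fun _ ht => (integrable_exp_gammaMeasure ha ht).1) isOpen_Iio

/-- The Laplace transform of the Gamma distribution on the closed right half-plane. -/
lemma integral_cexp_neg_mul_gammaMeasure {a : ℝ} (ha : 0 < a) {z : ℂ} (hz : 0 ≤ z.re) :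
    ∫ x : ℝ, Complex.exp (-z * x) ∂(gammaMeasure a 1) = Complex.exp (-(a * Complex.log (1 + z))) := by
  let U : Set ℂ := {z | z.re < 1}
  have hU : IsOpen U := isOpen_lt Complex.continuous_re continuous_const
  have hpre : IsPreconnected U := (convex_halfSpace_re_lt 1).isPreconnected
  have hf : AnalyticOnNhd ℂ (complexMGF id (gammaMeasure a 1)) U := by
    refine analyticOnNhd_complexMGF.mono fun z hz => ?_
    exact Iio_one_subset_integrableExpSet_gammaMeasure ha hz
  have hslit : ∀ z ∈ U, 1 - z ∈ Complex.slitPlane := fun z hz => Or.inl (by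
    have : z.re < 1 := hz
    simpa using this)
  have hg : AnalyticOnNhd ℂ (fun z => Complex.exp (-(a * Complex.log (1 - z)))) U := by
    refine DifferentiableOn.analyticOnNhd (fun z hz => ?_) hU
    have := hslit z hz
    apply DifferentiableAt.differentiableWithinAt
    fun_prop (disch := assumption)
  -- Identity theorem on `Re z < 1`: both sides are analytic there and agree at real points near
  -- `0`. The `complexMGF` has `exp(z x)`, so the result is read at `-z`.
  have key : EqOn (complexMGF id (gammaMeasure a 1))
      (fun z => Complex.exp (-(a * Complex.log (1 - z)))) U := by
    refine hf.eqOn_of_preconnected_of_frequently_eq hg hpre (z₀ := 0) (by simp [U]) ?_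
    have hreal : ∀ t : ℝ, t < 1 → complexMGF id (gammaMeasure a 1) t
        = Complex.exp (-(a * Complex.log (1 - (t : ℂ)))) := by
      intro t ht
      rw [complexMGF_ofReal, mgf]
      simp only [id]
      rw [(integrable_exp_gammaMeasure ha ht).2, one_div, Real.inv_rpow (by linarith),
        ← Real.rpow_neg (by linarith), Real.rpow_def_of_pos (by linarith)]
      push_cast
      rw [Complex.ofReal_log (by linarith)]
      push_cast
      congr 1
      ring
    have hfr : ∃ᶠ t : ℝ in 𝓝[≠] 0, complexMGF id (gammaMeasure a 1) t
        = Complex.exp (-(a * Complex.log (1 - (t : ℂ)))) := by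
      apply Eventually.frequently
      exact (eventually_nhdsWithin_of_eventually_nhds
        ((gt_mem_nhds zero_lt_one).mono fun t ht => hreal t ht))
    have htend : Tendsto (fun t : ℝ => (t : ℂ)) (𝓝[≠] 0) (𝓝[≠] 0) := by
      refine tendsto_nhdsWithin_iff.2 ⟨?_, ?_⟩
      · exact ((Complex.continuous_ofReal.tendsto' 0 0 (by simp))).mono_left nhdsWithin_le_nhds
      · filter_upwards [self_mem_nhdsWithin] with t ht
        simpa using ht
    exact htend.frequently hfr
  have := key (x := -z) (by simp only [U, mem_ofPred_eq, Complex.neg_re]; linarith)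
  simpa [complexMGF] using this

lemma memLp_id_gammaMeasure {a : ℝ} (ha : 0 < a) (r : ℝ≥0) :
    MemLp id r (gammaMeasure a 1) :=
  memLp_of_mem_interior_integrableExpSet
    (Iio_one_subset_integrableExpSet_gammaMeasure ha (by simp)) r

/-! ### Regular version of the process, path measures and their intensity. -/

section

lemma lebesgue_Ioc (a b : ℝ≥0) : lebesgue (Ioc a b) = ENNReal.ofReal ((b : ℝ) - a) := by
  have he : MeasurableEmbedding ((↑) : ℝ≥0 → ℝ) := MeasurableEmbedding.subtype_coe measurableSet_Ici
  rw [lebesgue, he.comap_apply]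
  have : ((↑) : ℝ≥0 → ℝ) '' Ioc a b = Ioc (a : ℝ) b := by
    ext x
    constructor
    · rintro ⟨y, hy, rfl⟩
      exact ⟨NNReal.coe_lt_coe.2 hy.1, NNReal.coe_le_coe.2 hy.2⟩
    · rintro ⟨h1, h2⟩
      refine ⟨⟨x, a.2.trans h1.le⟩, ⟨NNReal.coe_lt_coe.1 h1, NNReal.coe_le_coe.1 h2⟩, rfl⟩
  rw [this, Real.volume_Ioc]

instance isFiniteMeasure_lebesgue_restrict (a b : ℝ≥0) :
    IsFiniteMeasure (lebesgue.restrict (Ioc a b)) :=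
  ⟨by rw [Measure.restrict_apply_univ, lebesgue_Ioc]; exact ENNReal.ofReal_lt_top⟩

lemma pathMeasure_Ioc {X : ℝ≥0 → ℝ} (hm : Monotone X)
    (hc : ∀ t, ContinuousWithinAt X (Ici t) t) (a b : ℝ≥0) :
    pathMeasure X (Ioc a b) = ENNReal.ofReal (X b - X a) := by
  rw [pathMeasure, dif_pos ⟨hm, hc⟩, StieltjesFunction.measure_Ioc]

/-- A version of the Gamma process all of whose paths are increasing, right-continuous and start
at `0`, and which is measurable at each time. -/
structure IsRegularGammaProcess {Ω : Type*} [MeasurableSpace Ω] (S : ℝ≥0 → Ω → ℝ)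
    (P : Measure Ω) : Prop where
  measurable : ∀ t, Measurable (S t)
  zero : ∀ ω, S 0 ω = 0
  mono : ∀ ω, Monotone fun t => S t ω
  right_continuous : ∀ ω t, ContinuousWithinAt (fun u => S u ω) (Ici t) t
  indep_increments : HasIndepIncrements S P
  law_increment : ∀ s t : ℝ≥0, s < t →
    HasLaw (fun ω => S t ω - S s ω) (gammaMeasure ((t : ℝ) - (s : ℝ)) 1) P

variable {Ω : Type*} [MeasurableSpace Ω] {P : Measure Ω} {S : ℝ≥0 → Ω → ℝ}

/-- Bad paths are replaced by `0` on a measurable null set. Off this set `S` also agrees with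
measurable versions along a dense sequence of times, and right-continuity carries measurability from
these times to all others. -/
lemma IsGammaProcess.exists_regular (hS : IsGammaProcess S P) :
    ∃ S' : ℝ≥0 → Ω → ℝ, IsRegularGammaProcess S' P ∧ ∀ᵐ ω ∂P, ∀ t, S' t ω = S t ω := by
  classical
  have hmeas : ∀ t, AEMeasurable (S t) P := by
    intro t
    rcases eq_zero_or_pos t with rfl | ht
    · exact aemeasurable_const.congr (hS.start_zero.mono fun ω h => h.symm)
    · refine (hS.law_increment 0 t ht).aemeasurable.congr ?_
      filter_upwards [hS.start_zero] with ω h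
      simp [h]
  let d : ℕ → ℝ≥0 := TopologicalSpace.denseSeq ℝ≥0
  have hgood : ∀ᵐ ω ∂P, (S 0 ω = 0 ∧ (Monotone fun t => S t ω) ∧
      ∀ t, ContinuousWithinAt (fun u => S u ω) (Ici t) t) ∧
      ∀ n, S (d n) ω = (hmeas (d n)).mk _ ω := by
    filter_upwards [hS.start_zero, hS.monotone_path, hS.right_continuous_path,
      ae_all_iff.2 fun n => (hmeas (d n)).ae_eq_mk] with ω h1 h2 h3 h4
    exact ⟨⟨h1, h2, h3⟩, h4⟩
  let N := toMeasurable P {ω | ¬ ((S 0 ω = 0 ∧ (Monotone fun t => S t ω) ∧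
      ∀ t, ContinuousWithinAt (fun u => S u ω) (Ici t) t) ∧
      ∀ n, S (d n) ω = (hmeas (d n)).mk _ ω)}
  have hN0 : P N = 0 := by rw [measure_toMeasurable]; exact hgood
  have hN : MeasurableSet N := measurableSet_toMeasurable _ _
  have hNg : ∀ ω ∉ N, (S 0 ω = 0 ∧ (Monotone fun t => S t ω) ∧
      ∀ t, ContinuousWithinAt (fun u => S u ω) (Ici t) t) ∧
      ∀ n, S (d n) ω = (hmeas (d n)).mk _ ω := by
    intro ω hω
    by_contra h
    exact hω (subset_toMeasurable _ _ h)
  let S' : ℝ≥0 → Ω → ℝ := fun t ω => if ω ∈ N then 0 else S t ω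
  have hin : ∀ ω ∈ N, ∀ t, S' t ω = 0 := fun ω hω t => if_pos hω
  have hout : ∀ ω ∉ N, ∀ t, S' t ω = S t ω := fun ω hω t => if_neg hω
  have hS' : ∀ᵐ ω ∂P, ∀ t, S' t ω = S t ω := by
    filter_upwards [measure_eq_zero_iff_ae_notMem.1 hN0] with ω hω t using hout ω hω t
  refine ⟨S', ⟨?_, ?_, ?_, ?_, ?_, ?_⟩, hS'⟩
  · have hd : ∀ n, Measurable (S' (d n)) := by
      intro n
      have : S' (d n) = fun ω => if ω ∈ N then 0 else (hmeas (d n)).mk _ ω := by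
        ext ω
        by_cases hω : ω ∈ N
        · simp [S', hω]
        · simp [S', hω, (hNg ω hω).2 n]
      rw [this]
      exact Measurable.ite hN measurable_const (hmeas _).measurable_mk
    intro t
    -- The times of the dense sequence must approach `t` from the right, where paths are continuous.
    obtain ⟨u, -, hu⟩ : ∃ u : ℕ → ℝ≥0, StrictAnti u ∧ (∀ n, t < u n) ∧ Tendsto u atTop (𝓝 t) :=
      exists_seq_strictAnti_tendsto t
    have hex : ∀ n, ∃ k, d k ∈ Ioo t (u n) := fun n =>
      (TopologicalSpace.denseRange_denseSeq ℝ≥0).exists_mem_open isOpen_Ioo (nonempty_Ioo.2 (hu.1 n))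
    choose k hk using hex
    have hlim : Tendsto (fun n => d (k n)) atTop (𝓝[≥] t) := by
      refine tendsto_nhdsWithin_iff.2 ⟨?_, Eventually.of_forall fun n => (hk n).1.le⟩
      exact tendsto_of_tendsto_of_tendsto_of_le_of_le tendsto_const_nhds hu.2
        (fun n => (hk n).1.le) (fun n => (hk n).2.le)
    refine measurable_of_tendsto_metrizable (f := fun n => S' (d (k n))) (fun n => hd _) ?_
    rw [tendsto_pi_nhds]
    intro ω
    by_cases hω : ω ∈ N
    · simp [hin ω hω]
    · simp only [hout ω hω]
      exact ((hNg ω hω).1.2.2 t).tendsto.comp hlim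
  · intro ω
    by_cases hω : ω ∈ N
    · exact hin ω hω 0
    · rw [hout ω hω]; exact (hNg ω hω).1.1
  · intro ω
    by_cases hω : ω ∈ N
    · simp only [hin ω hω]; exact monotone_const
    · simp only [hout ω hω]; exact (hNg ω hω).1.2.1
  · intro ω t
    by_cases hω : ω ∈ N
    · simp only [hin ω hω]; exact continuousWithinAt_const
    · simp only [hout ω hω]; exact (hNg ω hω).1.2.2 t
  · intro n t ht
    refine (hS.indep_increments n t ht).congr fun i => ?_
    filter_upwards [hS'] with ω hω
    rw [hω, hω]
  · intro s t hst
    refine (hS.law_increment s t hst).congr ?_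
    filter_upwards [hS'] with ω hω
    rw [hω, hω]

namespace IsRegularGammaProcess

variable (hS : IsRegularGammaProcess S P)
include hS

lemma pathMeasure_Ioc (ω : Ω) (a b : ℝ≥0) :
    pathMeasure (fun u => S u ω) (Ioc a b) = ENNReal.ofReal (S b ω - S a ω) :=
  _root_.pathMeasure_Ioc (hS.mono ω) (hS.right_continuous ω) a b

lemma isFiniteMeasure_restrict (ω : Ω) (a b : ℝ≥0) :
    IsFiniteMeasure ((pathMeasure fun u => S u ω).restrict (Ioc a b)) :=
  ⟨by rw [Measure.restrict_apply_univ, hS.pathMeasure_Ioc]; exact ENNReal.ofReal_lt_top⟩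

/-- Makes the path measures a kernel, so that `∫ h dS` is measurable in `ω` and the intensity
measure can be expressed by `Measure.bind`. Half-lines suffice as test sets, and their masses are
increments of `S`. -/
lemma measurable_restrict (T : ℝ≥0) :
    Measurable fun ω => (pathMeasure fun u => S u ω).restrict (Ioc 0 T) := by
  have := fun ω => hS.isFiniteMeasure_restrict ω 0 T
  refine Measurable.measure_of_isPiSystem
    (BorelSpace.measurable_eq.trans (borel_eq_generateFrom_Iic ℝ≥0)) isPiSystem_Iic ?_ ?_
  · rintro _ ⟨b, rfl⟩
    simp only [Measure.restrict_apply measurableSet_Iic]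
    have : Iic b ∩ Ioc 0 T = Ioc 0 (min b T) := by ext; simp; tauto
    simp only [this, hS.pathMeasure_Ioc]
    exact ((hS.measurable _).sub (hS.measurable _)).ennreal_ofReal
  · simp only [Measure.restrict_apply_univ, hS.pathMeasure_Ioc]
    exact ((hS.measurable _).sub (hS.measurable _)).ennreal_ofReal

lemma lintegral_increment {a b : ℝ≥0} (hab : a ≤ b) :
    ∫⁻ ω, ENNReal.ofReal (S b ω - S a ω) ∂P = ENNReal.ofReal ((b : ℝ) - a) := by
  rcases hab.eq_or_lt with rfl | hab
  · simp
  · have hl := hS.law_increment a b hab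
    rw [← lintegral_ofReal_gammaMeasure (sub_pos.2 (NNReal.coe_lt_coe.2 hab)), ← hl.map_eq,
      lintegral_map' (by fun_prop) hl.aemeasurable]

/-- The intensity measure of a Gamma process is Lebesgue measure. -/
lemma bind_restrict (T : ℝ≥0) :
    P.bind (fun ω => (pathMeasure fun u => S u ω).restrict (Ioc 0 T))
      = lebesgue.restrict (Ioc 0 T) := by
  have key : ∀ s : Set ℝ≥0, MeasurableSet s → ∀ b ≤ T, s ∩ Ioc 0 T = Ioc 0 b →
      lebesgue.restrict (Ioc 0 T) s
        = P.bind (fun ω => (pathMeasure fun u => S u ω).restrict (Ioc 0 T)) s := by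
    intro s hs b hb hsb
    rw [Measure.bind_apply hs (hS.measurable_restrict T).aemeasurable,
      Measure.restrict_apply hs, hsb, lebesgue_Ioc]
    simp only [Measure.restrict_apply hs, hsb, hS.pathMeasure_Ioc]
    rw [hS.lintegral_increment (show (0 : ℝ≥0) ≤ b from bot_le)]
  symm
  refine ext_of_generate_finite _
    (BorelSpace.measurable_eq.trans (borel_eq_generateFrom_Iic ℝ≥0)) isPiSystem_Iic ?_
    (key _ MeasurableSet.univ T le_rfl (by simp))
  rintro _ ⟨b, rfl⟩
  exact key _ measurableSet_Iic (min b T) (min_le_right _ _) (by ext; simp; tauto)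

/-- Campbell's formula for the first moment. -/
lemma lintegral_lintegral {T : ℝ≥0} {h : ℝ≥0 → ℝ≥0∞} (hh : Measurable h) :
    ∫⁻ ω, ∫⁻ x in Ioc 0 T, h x ∂(pathMeasure fun u => S u ω) ∂P
      = ∫⁻ x in Ioc 0 T, h x ∂lebesgue := by
  rw [← hS.bind_restrict T, Measure.lintegral_bind (hS.measurable_restrict T).aemeasurable
    hh.aemeasurable]

lemma measurable_lintegral_path {T : ℝ≥0} {h : ℝ≥0 → ℝ≥0∞} (hh : Measurable h) :
    Measurable fun ω => ∫⁻ x in Ioc 0 T, h x ∂(pathMeasure fun u => S u ω) :=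
  (Measure.measurable_lintegral hh).comp (hS.measurable_restrict T)

lemma stronglyMeasurable_integral {E : Type*} [NormedAddCommGroup E] [NormedSpace ℝ E]
    {T : ℝ≥0} {h : ℝ≥0 → E} (hh : StronglyMeasurable h) :
    StronglyMeasurable fun ω => ∫ x in Ioc 0 T, h x ∂(pathMeasure fun u => S u ω) :=
  StronglyMeasurable.integral_kernel
    (κ := ⟨fun ω => (pathMeasure fun u => S u ω).restrict (Ioc 0 T), hS.measurable_restrict T⟩) hh

/-- Almost surely `dS` does not charge a given Lebesgue-null set, although `dS` itself may be
singular. Integrands may therefore be changed on such sets. -/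
lemma ae_ae_restrict {T : ℝ≥0} {p : ℝ≥0 → Prop} (h : ∀ᵐ x ∂lebesgue.restrict (Ioc 0 T), p x) :
    ∀ᵐ ω ∂P, ∀ᵐ x ∂(pathMeasure fun u => S u ω).restrict (Ioc 0 T), p x := by
  rw [← hS.bind_restrict T] at h
  exact Measure.ae_ae_of_ae_bind (hS.measurable_restrict T).aemeasurable h

lemma ae_integrableOn {E : Type*} [NormedAddCommGroup E] {T : ℝ≥0} {h : ℝ≥0 → E}
    (hh : StronglyMeasurable h) (hi : IntegrableOn h (Ioc 0 T) lebesgue) :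
    ∀ᵐ ω ∂P, IntegrableOn h (Ioc 0 T) (pathMeasure fun u => S u ω) := by
  have hfin : ∫⁻ ω, ∫⁻ x in Ioc 0 T, ‖h x‖ₑ ∂(pathMeasure fun u => S u ω) ∂P ≠ ∞ := by
    rw [hS.lintegral_lintegral hh.enorm]
    exact hi.2.ne
  filter_upwards [ae_lt_top (hS.measurable_lintegral_path hh.enorm) hfin] with ω hω
  exact ⟨hh.aestronglyMeasurable, hω⟩

lemma ae_forall_integrableOn {E : Type*} [NormedAddCommGroup E] {h : ℝ≥0 → E}
    (hh : StronglyMeasurable h) (hi : ∀ T, IntegrableOn h (Ioc 0 T) lebesgue) :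
    ∀ᵐ ω ∂P, ∀ T, IntegrableOn h (Ioc 0 T) (pathMeasure fun u => S u ω) := by
  filter_upwards [ae_all_iff.2 fun n : ℕ => hS.ae_integrableOn hh (hi n)] with ω hω T
  obtain ⟨n, hn⟩ := exists_nat_ge T
  exact (hω n).mono_set (Ioc_subset_Ioc_right hn)

end IsRegularGammaProcess

end

/-! ### Step functions on the grid and the Laplace functional. -/

section

lemma setIntegral_Ioc_eq_sum {E : Type*} [NormedAddCommGroup E] [NormedSpace ℝ E]
    {μ : Measure ℝ≥0} {k : ℝ≥0 → E} {τ : ℕ → ℝ≥0} (hτ : Monotone τ) (n : ℕ)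
    (hk : IntegrableOn k (Ioc (τ 0) (τ n)) μ) :
    ∫ x in Ioc (τ 0) (τ n), k x ∂μ = ∑ j ∈ Finset.range n, ∫ x in Ioc (τ j) (τ (j + 1)), k x ∂μ := by
  induction n with
  | zero => simp
  | succ n ih =>
    have h0 := hτ (Nat.zero_le n)
    have h1 := hτ (Nat.le_succ n)
    rw [Finset.sum_range_succ, ← ih (hk.mono_set (Ioc_subset_Ioc_right h1)),
      ← setIntegral_union (Ioc_disjoint_Ioc_of_le le_rfl) measurableSet_Ioc
        (hk.mono_set (Ioc_subset_Ioc_right h1)) (hk.mono_set (Ioc_subset_Ioc_left h0)),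
      Ioc_union_Ioc_eq_Ioc h0 h1]

lemma node_mono (p q : ℝ≥0) : Monotone (node p q) := by
  intro m n h
  unfold node
  gcongr

/-- The function which equals `k t_{j+1}` on each interval `(t_j, t_{j+1}]` between the nodes. -/
noncomputable def gridStep {E : Type*} (p q : ℝ≥0) (k : ℝ≥0 → E) (x : ℝ≥0) : E :=
  k (node p q ⌈(x - p) / q⌉₊)

lemma gridStep_eq {E : Type*} {p q : ℝ≥0} (hq : 0 < q) (k : ℝ≥0 → E) {j : ℕ} {x : ℝ≥0}
    (hx : x ∈ Ioc (node p q j) (node p q (j + 1))) : gridStep p q k x = k (node p q (j + 1)) := by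
  have h : ⌈(x - p) / q⌉₊ = j + 1 := by
    rw [Nat.ceil_eq_iff (Nat.succ_ne_zero j)]
    obtain ⟨h1, h2⟩ := hx
    unfold node at h1 h2
    constructor
    · rw [Nat.succ_sub_one, lt_div_iff₀ hq, lt_tsub_iff_left, mul_comm]
      exact h1
    · rw [div_le_iff₀ hq, tsub_le_iff_left, mul_comm]
      exact_mod_cast h2
  rw [gridStep, h]

lemma measurable_gridStep {E : Type*} [MeasurableSpace E] (p q : ℝ≥0) (k : ℝ≥0 → E) :
    Measurable (gridStep p q k) := by
  have : Measurable fun n : ℕ => k (node p q n) := measurable_from_top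
  exact this.comp (Nat.measurable_ceil.comp (by fun_prop))

lemma integrableOn_gridStep {E : Type*} [NormedAddCommGroup E] [MeasurableSpace E] [BorelSpace E]
    [SecondCountableTopology E]
    {μ : Measure ℝ≥0} (hμ : ∀ a b, IsFiniteMeasure (μ.restrict (Ioc a b)))
    {p q : ℝ≥0} (hq : 0 < q) (k : ℝ≥0 → E) (n : ℕ) :
    IntegrableOn (gridStep p q k) (Ioc (node p q 0) (node p q n)) μ := by
  induction n with
  | zero => simp
  | succ n ih =>
    have h0 := node_mono p q (Nat.zero_le n)
    have h1 := node_mono p q (Nat.le_succ n)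
    rw [← Ioc_union_Ioc_eq_Ioc h0 h1]
    refine ih.union ?_
    have := hμ (node p q n) (node p q (n + 1))
    refine (integrable_const (μ := μ.restrict (Ioc (node p q n) (node p q (n + 1))))
      (k (node p q (n + 1)))).congr ?_
    filter_upwards [ae_restrict_mem measurableSet_Ioc] with x hx
    exact (gridStep_eq hq k hx).symm

lemma setIntegral_gridStep {E : Type*} [NormedAddCommGroup E] [NormedSpace ℝ E]
    [CompleteSpace E] [MeasurableSpace E] [BorelSpace E] [SecondCountableTopology E]
    {μ : Measure ℝ≥0} (hμ : ∀ a b, IsFiniteMeasure (μ.restrict (Ioc a b)))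
    {p q : ℝ≥0} (hq : 0 < q) (k : ℝ≥0 → E) (n : ℕ) :
    ∫ x in Ioc (node p q 0) (node p q n), gridStep p q k x ∂μ
      = ∑ j ∈ Finset.range n, μ.real (Ioc (node p q j) (node p q (j + 1))) •
          k (node p q (j + 1)) := by
  rw [setIntegral_Ioc_eq_sum (node_mono p q) n (integrableOn_gridStep hμ hq k n)]
  refine Finset.sum_congr rfl fun j _ => ?_
  rw [setIntegral_congr_fun measurableSet_Ioc fun x hx => gridStep_eq hq k hx, setIntegral_const]

lemma lebesgue_real_Ioc {a b : ℝ≥0} (hab : a ≤ b) : lebesgue.real (Ioc a b) = b - a := by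
  rw [Measure.real, lebesgue_Ioc, ENNReal.toReal_ofReal (sub_nonneg.2 (NNReal.coe_le_coe.2 hab))]

lemma node_succ_sub (p q : ℝ≥0) (j : ℕ) : ((node p q (j + 1) : ℝ≥0) : ℝ) - node p q j = q := by
  simp [node]; ring

/-- The derivative has modulus `exp(-Re z) ≤ 1` on the convex right half-plane. With the analogous
bound for `log(1 + z)`, this makes both sides of the Laplace formula Lipschitz in the integrand. -/
lemma norm_exp_neg_sub_exp_neg_le {z w : ℂ} (hz : 0 ≤ z.re) (hw : 0 ≤ w.re) :
    ‖Complex.exp (-z) - Complex.exp (-w)‖ ≤ ‖z - w‖ := by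
  have := (convex_halfSpace_re_ge 0).norm_image_sub_le_of_norm_hasDerivWithin_le
    (f := fun z => Complex.exp (-z)) (f' := fun z => Complex.exp (-z) * (-1)) (C := 1) (x := w)
    (y := z) (fun x _ => ((hasDerivAt_neg x).cexp).hasDerivWithinAt) (fun x hx => by
      have hx : 0 ≤ x.re := hx
      simpa [Complex.norm_exp] using hx) hw hz
  simpa using this

lemma one_le_norm_one_add {z : ℂ} (hz : 0 ≤ z.re) : 1 ≤ ‖1 + z‖ := by
  have := Complex.re_le_norm (1 + z)
  simp at this
  linarith

lemma norm_log_one_add_sub_le {z w : ℂ} (hz : 0 ≤ z.re) (hw : 0 ≤ w.re) :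
    ‖Complex.log (1 + z) - Complex.log (1 + w)‖ ≤ ‖z - w‖ := by
  have := (convex_halfSpace_re_ge 0).norm_image_sub_le_of_norm_hasDerivWithin_le
    (f := fun z => Complex.log (1 + z)) (f' := fun z => 1 / (1 + z)) (C := 1) (x := w)
    (y := z) (fun x hx => (((hasDerivAt_id x).const_add 1).clog (Or.inl (by
      have hx : 0 ≤ x.re := hx
      simp; linarith))).hasDerivWithinAt) (fun x hx => by
      have hx : 0 ≤ x.re := hx
      rw [norm_div, norm_one]
      exact (div_le_one (by linarith [one_le_norm_one_add hx])).2 (one_le_norm_one_add hx)) hw hz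
  simpa using this

lemma norm_log_one_add_le {z : ℂ} (hz : 0 ≤ z.re) : ‖Complex.log (1 + z)‖ ≤ ‖z‖ := by
  simpa using norm_log_one_add_sub_le hz (w := 0) (by simp)

lemma re_log_one_add_nonneg {z : ℂ} (hz : 0 ≤ z.re) : 0 ≤ (Complex.log (1 + z)).re := by
  rw [Complex.log_re]
  exact Real.log_nonneg (one_le_norm_one_add hz)

lemma integrable_log_one_add {α : Type*} [MeasurableSpace α] {μ : Measure α} {k : α → ℂ}
    (hk : Integrable k μ) (hre : ∀ x, 0 ≤ (k x).re) :
    Integrable (fun x => Complex.log (1 + k x)) μ := by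
  refine hk.mono ?_ (ae_of_all _ fun x => norm_log_one_add_le (hre x))
  exact (Complex.measurable_log.comp_aemeasurable
    (hk.aemeasurable.const_add 1)).aestronglyMeasurable

lemma re_integral_nonneg {α : Type*} [MeasurableSpace α] {μ : Measure α} {k : α → ℂ}
    (hre : ∀ x, 0 ≤ (k x).re) : 0 ≤ (∫ x, k x ∂μ).re := by
  by_cases hk : Integrable k μ
  · have := integral_nonneg (μ := μ) (f := fun x => (k x).re) hre
    rwa [show ∫ x, (k x).re ∂μ = (∫ x, k x ∂μ).re from integral_re hk] at this
  -- A non-integrable `k` has integral `0` by convention, so no integrability is needed.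
  · simp [integral_undef hk]

variable {Ω : Type*} [MeasurableSpace Ω] {P : Measure Ω}
  {S : ℝ≥0 → Ω → ℝ}

namespace IsRegularGammaProcess

variable (hS : IsRegularGammaProcess S P)
include hS

/-- For a step function the integral is a linear combination of independent increments, and the
expectation factors into Gamma Laplace transforms. -/
lemma laplace_gridStep {q : ℝ≥0} (hq : 0 < q) {k : ℝ≥0 → ℂ} (hre : ∀ x, 0 ≤ (k x).re) (n : ℕ) :
    ∫ ω, Complex.exp (-∫ x in Ioc 0 (node 0 q n), gridStep 0 q k x ∂(pathMeasure fun u => S u ω)) ∂P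
      = Complex.exp (-∫ x in Ioc 0 (node 0 q n), Complex.log (1 + gridStep 0 q k x) ∂lebesgue) := by
  have h0 : node 0 q 0 = 0 := by simp [node]
  -- `gridStep` only samples its argument, hence commutes with every function applied to the values.
  have hlog : (fun x => Complex.log (1 + gridStep 0 q k x))
      = gridStep 0 q fun x => Complex.log (1 + k x) := rfl
  have hlt : ∀ j, node 0 q j < node 0 q (j + 1) := fun j => by simp [node, mul_add, hq]
  rw [hlog]
  have e1 := setIntegral_gridStep (μ := lebesgue) (p := 0) isFiniteMeasure_lebesgue_restrict hq
    (fun x => Complex.log (1 + k x)) n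
  have e2 := fun ω => setIntegral_gridStep (p := 0)
    (fun a b => hS.isFiniteMeasure_restrict ω a b) hq k n
  rw [h0] at e1 e2
  simp only [e1, e2]
  have hr : ∀ ω j, (pathMeasure fun u => S u ω).real (Ioc (node 0 q j) (node 0 q (j + 1)))
      = S (node 0 q (j + 1)) ω - S (node 0 q j) ω := by
    intro ω j
    rw [Measure.real, hS.pathMeasure_Ioc, ENNReal.toReal_ofReal]
    exact sub_nonneg.2 (hS.mono ω (hlt j).le)
  have hl : ∀ j, lebesgue.real (Ioc (node 0 q j) (node 0 q (j + 1))) = q := fun j => by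
    rw [lebesgue_real_Ioc (hlt j).le, node_succ_sub]
  simp only [hr, hl, ← Finset.sum_neg_distrib, Complex.exp_sum]
  have hind := (hS.indep_increments.nat (node_mono 0 q)).precomp
    (g := ((↑) : Finset.range n → ℕ)) Subtype.val_injective
  have := hind.integral_fun_prod_comp (f := fun (j : Finset.range n) (x : ℝ) =>
      Complex.exp (-(x • k (node 0 q (j + 1)))))
    (fun j => ((hS.measurable _).sub (hS.measurable _)).aemeasurable)
    (fun j => Continuous.aestronglyMeasurable (by fun_prop))
  refine (integral_congr_ae (ae_of_all _ fun ω => (Finset.prod_coe_sort (Finset.range n)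
    (fun j => Complex.exp (-((S (node 0 q (j + 1)) ω - S (node 0 q j) ω) •
      k (node 0 q (j + 1)))))).symm)).trans (this.trans ?_)
  rw [Finset.prod_coe_sort (Finset.range n) (fun j => ∫ ω, Complex.exp
    (-((S (node 0 q (j + 1)) ω - S (node 0 q j) ω) • k (node 0 q (j + 1)))) ∂P)]
  refine Finset.prod_congr rfl fun j _ => ?_
  have hlaw := hS.law_increment _ _ (hlt j)
  rw [node_succ_sub] at hlaw
  have hL := integral_cexp_neg_mul_gammaMeasure (a := q) (NNReal.coe_pos.2 hq) (hre (node 0 q (j + 1)))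
  rw [← hlaw.map_eq, integral_map hlaw.aemeasurable
    (Continuous.aestronglyMeasurable (by fun_prop))] at hL
  rw [Complex.real_smul, ← hL]
  congr 1
  ext ω
  rw [Complex.real_smul]
  congr 1
  ring

variable [IsProbabilityMeasure P]

/-- Both sides are 1-Lipschitz in `k` for the `L¹` distance with respect to Lebesgue measure, so the
identity passes to `L¹` limits. -/
lemma laplace_of_approx {T : ℝ≥0} {k : ℝ≥0 → ℂ} (hk : Measurable k)
    (hi : IntegrableOn k (Ioc 0 T) lebesgue) (hre : ∀ x, 0 ≤ (k x).re)
    (happ : ∀ ε : ℝ≥0∞, 0 < ε → ∃ k' : ℝ≥0 → ℂ, Measurable k' ∧ (∀ x, 0 ≤ (k' x).re) ∧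
      IntegrableOn k' (Ioc 0 T) lebesgue ∧ ∫⁻ x in Ioc 0 T, ‖k x - k' x‖ₑ ∂lebesgue ≤ ε ∧
      ∫ ω, Complex.exp (-∫ x in Ioc 0 T, k' x ∂(pathMeasure fun u => S u ω)) ∂P
        = Complex.exp (-∫ x in Ioc 0 T, Complex.log (1 + k' x) ∂lebesgue)) :
    ∫ ω, Complex.exp (-∫ x in Ioc 0 T, k x ∂(pathMeasure fun u => S u ω)) ∂P
      = Complex.exp (-∫ x in Ioc 0 T, Complex.log (1 + k x) ∂lebesgue) := by
  rw [← sub_eq_zero, ← enorm_eq_zero, ← le_zero_iff]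
  refine le_of_forall_pos_le_add fun ε hε => ?_
  obtain ⟨k', hk', hre', hi', hε', he⟩ := happ (ε / 2) (ENNReal.half_pos hε.ne')
  have hint : ∀ {k : ℝ≥0 → ℂ}, Measurable k → (∀ x, 0 ≤ (k x).re) →
      Integrable (fun ω => Complex.exp (-∫ x in Ioc 0 T, k x ∂(pathMeasure fun u => S u ω))) P := by
    intro k hk hre
    refine Integrable.of_bound (C := 1) ?_ (ae_of_all _ fun ω => ?_)
    · exact (hS.stronglyMeasurable_integral hk.stronglyMeasurable).measurable.neg.cexp.aestronglyMeasurable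
    · rw [Complex.norm_exp, Complex.neg_re]
      exact Real.exp_le_one_iff.2 (neg_nonpos.2 (re_integral_nonneg hre))
  -- The left side: the Lipschitz bound gives `E ∫ |k - k'| dS`, which Campbell's formula turns into
  -- `∫ |k - k'| dx`.
  have h1 : ‖∫ ω, Complex.exp (-∫ x in Ioc 0 T, k x ∂(pathMeasure fun u => S u ω)) ∂P
      - ∫ ω, Complex.exp (-∫ x in Ioc 0 T, k' x ∂(pathMeasure fun u => S u ω)) ∂P‖ₑ ≤ ε / 2 := by
    rw [← integral_sub (hint hk hre) (hint hk' hre')]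
    refine (enorm_integral_le_lintegral_enorm _).trans (le_trans ?_ hε')
    refine le_trans ?_ (hS.lintegral_lintegral (hk.sub hk').enorm).le
    refine lintegral_mono_ae ?_
    filter_upwards [hS.ae_integrableOn hk.stronglyMeasurable hi,
      hS.ae_integrableOn hk'.stronglyMeasurable hi'] with ω hω hω'
    refine le_trans ?_ (enorm_integral_le_lintegral_enorm _)
    rw [enorm_le_iff_norm_le, integral_sub' hω hω']
    exact norm_exp_neg_sub_exp_neg_le (re_integral_nonneg hre) (re_integral_nonneg hre')
  have h2 : ‖Complex.exp (-∫ x in Ioc 0 T, Complex.log (1 + k x) ∂lebesgue)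
      - Complex.exp (-∫ x in Ioc 0 T, Complex.log (1 + k' x) ∂lebesgue)‖ₑ ≤ ε / 2 := by
    refine le_trans ?_ hε'
    have : ‖Complex.exp (-∫ x in Ioc 0 T, Complex.log (1 + k x) ∂lebesgue)
      - Complex.exp (-∫ x in Ioc 0 T, Complex.log (1 + k' x) ∂lebesgue)‖ₑ ≤
        ‖∫ x in Ioc 0 T, (Complex.log (1 + k x) - Complex.log (1 + k' x)) ∂lebesgue‖ₑ := by
      rw [enorm_le_iff_norm_le, integral_sub (integrable_log_one_add hi hre)
        (integrable_log_one_add hi' hre')]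
      exact norm_exp_neg_sub_exp_neg_le (re_integral_nonneg fun x => re_log_one_add_nonneg (hre x))
        (re_integral_nonneg fun x => re_log_one_add_nonneg (hre' x))
    refine this.trans ((enorm_integral_le_lintegral_enorm _).trans (lintegral_mono fun x => ?_))
    rw [enorm_le_iff_norm_le]
    exact norm_log_one_add_sub_le (hre x) (hre' x)
  rw [zero_add, ← ENNReal.add_halves ε, ← edist_eq_enorm_sub]
  refine (edist_triangle _ _ _).trans (add_le_add (by rw [edist_eq_enorm_sub]; exact h1) ?_)
  rw [he, edist_comm, edist_eq_enorm_sub]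
  exact h2

omit hS in
lemma tendsto_gridStep {E : Type*} [TopologicalSpace E] {T : ℝ≥0} (hT : 0 < T) {k : ℝ≥0 → E}
    (hk : Continuous k) (x : ℝ≥0) :
    Tendsto (fun n : ℕ => gridStep 0 (T / (n + 1 : ℕ)) k x) atTop (𝓝 (k x)) := by
  refine (hk.tendsto x).comp ?_
  have hlim : Tendsto (fun n : ℕ => x + T / (n + 1 : ℕ)) atTop (𝓝 x) := by
    have : Tendsto (fun n : ℕ => T / ((n + 1 : ℕ) : ℝ≥0)) atTop (𝓝 0) := by
      have := tendsto_const_div_atTop_nhds_zero_nat (𝕜 := ℝ) (T : ℝ)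
      have := (tendsto_add_atTop_iff_nat 1).2 this
      rw [← NNReal.tendsto_coe]
      simpa using this
    simpa using this.const_add x
  have hq : ∀ n : ℕ, 0 < T / ((n + 1 : ℕ) : ℝ≥0) := fun n => by positivity
  refine tendsto_of_tendsto_of_tendsto_of_le_of_le tendsto_const_nhds hlim (fun n => ?_) fun n => ?_
  · simp only [node, zero_add, tsub_zero]
    rw [mul_comm, ← div_le_iff₀ (hq n)]
    exact Nat.le_ceil _
  · simp only [node, zero_add, tsub_zero]
    have := (Nat.ceil_lt_add_one (show 0 ≤ x / (T / ((n + 1 : ℕ) : ℝ≥0)) from bot_le)).le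
    calc T / ((n + 1 : ℕ) : ℝ≥0) * ⌈x / (T / ((n + 1 : ℕ) : ℝ≥0))⌉₊
        ≤ T / ((n + 1 : ℕ) : ℝ≥0) * (x / (T / ((n + 1 : ℕ) : ℝ≥0)) + 1) := by gcongr
      _ = x + T / ((n + 1 : ℕ) : ℝ≥0) := by rw [mul_add, mul_div_cancel₀ _ (hq n).ne', mul_one]

lemma laplace_of_continuous {T : ℝ≥0} {k : ℝ≥0 → ℂ} (hk : Continuous k) {C : ℝ}
    (hC : ∀ x, ‖k x‖ ≤ C) (hre : ∀ x, 0 ≤ (k x).re) :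
    ∫ ω, Complex.exp (-∫ x in Ioc 0 T, k x ∂(pathMeasure fun u => S u ω)) ∂P
      = Complex.exp (-∫ x in Ioc 0 T, Complex.log (1 + k x) ∂lebesgue) := by
  rcases eq_zero_or_pos T with rfl | hT
  · simp
  have hbdd : ∀ {k : ℝ≥0 → ℂ}, Measurable k → (∀ x, ‖k x‖ ≤ C) →
      IntegrableOn k (Ioc 0 T) lebesgue := fun hk hC =>
    Integrable.of_bound hk.aestronglyMeasurable C (ae_of_all _ hC)
  refine hS.laplace_of_approx hk.measurable (hbdd hk.measurable hC) hre fun ε hε => ?_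
  have hlim : Tendsto (fun n : ℕ => ∫⁻ x in Ioc 0 T,
      ‖k x - gridStep 0 (T / (n + 1 : ℕ)) k x‖ₑ ∂lebesgue) atTop (𝓝 0) := by
    rw [← lintegral_zero (μ := lebesgue.restrict (Ioc 0 T))]
    refine tendsto_lintegral_of_dominated_convergence (fun _ => ENNReal.ofReal (C + C))
      (fun n => (hk.measurable.sub (measurable_gridStep _ _ _)).enorm) (fun n => ?_) ?_ ?_
    · refine ae_of_all _ fun x => ?_
      change ‖_‖ₑ ≤ ENNReal.ofReal (C + C)
      rw [← ofReal_norm]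
      exact ENNReal.ofReal_le_ofReal ((norm_sub_le _ _).trans (add_le_add (hC _) (hC _)))
    · rw [lintegral_const]
      exact ENNReal.mul_ne_top ENNReal.ofReal_ne_top (measure_ne_top _ _)
    · refine ae_of_all _ fun x => ?_
      have := ((tendsto_gridStep hT hk x).const_sub (k x)).enorm
      simpa using this
  obtain ⟨n, hn⟩ := (hlim.eventually (gt_mem_nhds hε)).exists
  have hq : 0 < T / ((n + 1 : ℕ) : ℝ≥0) := by positivity
  refine ⟨gridStep 0 (T / (n + 1 : ℕ)) k, measurable_gridStep _ _ _, fun x => hre _,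
    hbdd (measurable_gridStep _ _ _) fun x => hC _, hn.le, ?_⟩
  -- The mesh `T / (n + 1)` is chosen so that `T` itself is a node.
  have hN : node 0 (T / ((n + 1 : ℕ) : ℝ≥0)) (n + 1) = T := by
    simp only [node, zero_add]
    rw [div_mul_cancel₀]
    positivity
  have := hS.laplace_gridStep hq hre (n + 1)
  rwa [hN] at this

/-- The Laplace functional of a Gamma process. -/
theorem laplace {T : ℝ≥0} {k : ℝ≥0 → ℂ} (hk : Measurable k)
    (hi : IntegrableOn k (Ioc 0 T) lebesgue) (hre : ∀ x, 0 ≤ (k x).re) :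
    ∫ ω, Complex.exp (-∫ x in Ioc 0 T, k x ∂(pathMeasure fun u => S u ω)) ∂P
      = Complex.exp (-∫ x in Ioc 0 T, Complex.log (1 + k x) ∂lebesgue) := by
  refine hS.laplace_of_approx hk hi hre fun ε hε => ?_
  obtain ⟨g, hg, -⟩ := hi.exists_boundedContinuous_lintegral_sub_le hε.ne'
  -- Reflecting the continuous approximant into the right half-plane keeps its modulus and, since
  -- `Re k ≥ 0`, does not increase its distance to `k`.
  let g' : ℝ≥0 → ℂ := fun x => (|(g x).re| : ℝ) + (g x).im * Complex.I
  have hre' : ∀ x, (g' x).re = |(g x).re| := fun x => by simp [g']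
  have him' : ∀ x, (g' x).im = (g x).im := fun x => by simp [g']
  have hg'c : Continuous g' := by fun_prop
  have hnorm : ∀ x, ‖g' x‖ = ‖g x‖ := fun x => by
    rw [Complex.norm_def, Complex.norm_def, Complex.normSq_apply, Complex.normSq_apply, hre', him',
      abs_mul_abs_self]
  have hb : ∀ x, ‖g' x‖ ≤ ‖g‖ := fun x => (hnorm x).trans_le (g.norm_coe_le_norm x)
  have hp : ∀ x, 0 ≤ (g' x).re := fun x => by rw [hre']; exact abs_nonneg _
  refine ⟨g', hg'c.measurable, hp,
    Integrable.of_bound hg'c.measurable.aestronglyMeasurable _ (ae_of_all _ hb), ?_,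
    hS.laplace_of_continuous hg'c hb hp⟩
  refine le_trans (lintegral_mono fun x => ?_) hg
  rw [enorm_le_iff_norm_le, Complex.norm_def, Complex.norm_def]
  refine Real.sqrt_le_sqrt ?_
  simp only [Complex.normSq_apply, Complex.sub_re, Complex.sub_im, hre', him']
  have h0 := hre x
  have h1 : (k x).re * (g x).re ≤ (k x).re * |(g x).re| :=
    mul_le_mul_of_nonneg_left (le_abs_self _) h0
  nlinarith [abs_mul_abs_self (g x).re]

end IsRegularGammaProcess

end

/-! ### Joint laws of Gamma integrals over successive intervals. -/

section

variable {Ω : Type*} [MeasurableSpace Ω] {P : Measure Ω} {S : ℝ≥0 → Ω → ℝ}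

namespace IsRegularGammaProcess

variable (hS : IsRegularGammaProcess S P)
include hS

lemma measurable_setIntegral_Ioc {h : ℝ≥0 → ℝ} (hh : Measurable h) (a b : ℝ≥0) :
    Measurable fun ω => ∫ x in Ioc a b, h x ∂(pathMeasure fun u => S u ω) := by
  have h1 : ∀ ω, ∫ x in Ioc a b, h x ∂(pathMeasure fun u => S u ω)
      = ∫ x in Ioc 0 b, (Ioc a b).indicator h x ∂(pathMeasure fun u => S u ω) := fun ω => by
    rw [setIntegral_indicator measurableSet_Ioc,
      inter_eq_self_of_subset_right (Ioc_subset_Ioc_left (show (0 : ℝ≥0) ≤ a from bot_le))]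
  simp only [h1]
  exact (hS.stronglyMeasurable_integral
    (hh.indicator measurableSet_Ioc).stronglyMeasurable).measurable

variable [IsProbabilityMeasure P]

/-- The linear combination is a single integral of `C h`, with `C = c j` on the `j`-th interval. The
Laplace functional applies at `k = -i C h`, whose real part is `0`. -/
lemma charFun_sum_integrals {h : ℝ≥0 → ℝ} (hh : Measurable h)
    (hi : ∀ T, IntegrableOn h (Ioc 0 T) lebesgue) {τ : ℕ → ℝ≥0} (hτ : Monotone τ) (c : ℕ → ℝ)
    (N : ℕ) :
    ∫ ω, Complex.exp (Complex.I * ↑(∑ j ∈ Finset.range N,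
      c j * ∫ x in Ioc (τ j) (τ (j + 1)), h x ∂(pathMeasure fun u => S u ω))) ∂P
      = Complex.exp (-∑ j ∈ Finset.range N, ∫ x in Ioc (τ j) (τ (j + 1)),
          Complex.log (1 + (-Complex.I * (c j * h x : ℝ))) ∂lebesgue) := by
  let C : ℝ≥0 → ℝ := fun x => ∑ j ∈ Finset.range N, (Ioc (τ j) (τ (j + 1))).indicator (fun _ => c j) x
  have hC : Measurable C := Finset.measurable_fun_sum _ fun j _ =>
    measurable_const.indicator measurableSet_Ioc
  have hCj : ∀ j ∈ Finset.range N, ∀ x ∈ Ioc (τ j) (τ (j + 1)), C x = c j := by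
    intro j hj x hx
    refine (Finset.sum_eq_single_of_mem j hj fun i _ hij => ?_).trans (indicator_of_mem hx _)
    exact indicator_of_notMem
      (fun hx' => (hτ.pairwise_disjoint_on_Ioc_succ hij).le_bot ⟨hx', hx⟩) _
  have hC0 : ∀ x ∈ Ioc 0 (τ N) \ Ioc (τ 0) (τ N), C x = 0 := by
    intro x hx
    refine Finset.sum_eq_zero fun j _ => indicator_of_notMem (fun hx' => hx.2 ⟨?_, hx.1.2⟩) _
    exact (hτ (Nat.zero_le j)).trans_lt hx'.1
  have hCb : ∃ B, ∀ x, ‖C x‖ ≤ B := by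
    refine ⟨∑ j ∈ Finset.range N, ‖c j‖, fun x => norm_sum_le_of_le _ fun j _ => ?_⟩
    exact norm_indicator_le_norm_self (fun _ => c j) x
  obtain ⟨B, hB⟩ := hCb
  let k : ℝ≥0 → ℂ := fun x => -Complex.I * (C x * h x : ℝ)
  have hk : Measurable k := by fun_prop
  have hre : ∀ x, 0 ≤ (k x).re := fun x => by simp [k]
  have hki : ∀ {μ : Measure ℝ≥0}, IntegrableOn h (Ioc 0 (τ N)) μ →
      IntegrableOn k (Ioc 0 (τ N)) μ := by
    intro μ hμ
    exact ((hμ.bdd_mul hC.aestronglyMeasurable (ae_of_all _ hB)).ofReal (𝕜 := ℂ)).const_mul _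
  have hsub : Ioc (τ 0) (τ N) ⊆ Ioc 0 (τ N) := Ioc_subset_Ioc_left bot_le
  have key := hS.laplace (T := τ N) hk (hki (hi _)) hre
  have e1 : ∫ x in Ioc 0 (τ N), Complex.log (1 + k x) ∂lebesgue
      = ∑ j ∈ Finset.range N, ∫ x in Ioc (τ j) (τ (j + 1)),
          Complex.log (1 + (-Complex.I * (c j * h x : ℝ))) ∂lebesgue := by
    rw [setIntegral_eq_of_subset_of_forall_sdiff_eq_zero measurableSet_Ioc hsub
      (fun x hx => by simp [k, hC0 x hx]), setIntegral_Ioc_eq_sum hτ N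
      (IntegrableOn.mono_set (integrable_log_one_add (hki (hi _)) hre) hsub)]
    refine Finset.sum_congr rfl fun j hj => setIntegral_congr_fun measurableSet_Ioc fun x hx => ?_
    simp only [k, hCj j hj x hx]
  rw [e1] at key
  rw [← key]
  refine integral_congr_ae ?_
  filter_upwards [hS.ae_integrableOn hh.stronglyMeasurable (hi (τ N))] with ω hω
  congr 1
  rw [setIntegral_eq_of_subset_of_forall_sdiff_eq_zero measurableSet_Ioc hsub
    (fun x hx => by simp [k, hC0 x hx]), setIntegral_Ioc_eq_sum hτ N ((hki hω).mono_set hsub),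
    Complex.ofReal_sum, Finset.mul_sum, ← Finset.sum_neg_distrib]
  refine Finset.sum_congr rfl fun j hj => ?_
  rw [setIntegral_congr_fun (g := fun x => -Complex.I * (c j * h x : ℝ)) measurableSet_Ioc
    fun x hx => by simp only [k, hCj j hj x hx], integral_const_mul, integral_complex_ofReal,
    integral_const_mul]
  ring

/-- The joint law of the integrals of `h` over successive intervals depends only on the
distribution of `h` on each of them. -/
lemma identDistrib_increments {h h' : ℝ≥0 → ℝ} (hh : Measurable h) (hh' : Measurable h')
    (hi : ∀ T, IntegrableOn h (Ioc 0 T) lebesgue) (hi' : ∀ T, IntegrableOn h' (Ioc 0 T) lebesgue)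
    {τ τ' : ℕ → ℝ≥0} (hτ : Monotone τ) (hτ' : Monotone τ')
    (hid : ∀ j, IdentDistrib h h' (lebesgue.restrict (Ioc (τ j) (τ (j + 1))))
      (lebesgue.restrict (Ioc (τ' j) (τ' (j + 1))))) :
    IdentDistrib
      (fun ω (j : ℕ) => ∫ x in Ioc (τ j) (τ (j + 1)), h x ∂(pathMeasure fun u => S u ω))
      (fun ω (j : ℕ) => ∫ x in Ioc (τ' j) (τ' (j + 1)), h' x ∂(pathMeasure fun u => S u ω)) P P := by
  have hm : ∀ {h : ℝ≥0 → ℝ} (_ : Measurable h) (τ : ℕ → ℝ≥0), Measurable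
      (fun ω (j : ℕ) => ∫ x in Ioc (τ j) (τ (j + 1)), h x ∂(pathMeasure fun u => S u ω)) :=
    fun hh τ => measurable_pi_lambda _ fun j => hS.measurable_setIntegral_Ioc hh _ _
  refine (identDistrib_iff_forall_finset_identDistrib
    (X := fun (j : ℕ) ω => ∫ x in Ioc (τ j) (τ (j + 1)), h x ∂(pathMeasure fun u => S u ω))
    (Y := fun (j : ℕ) ω => ∫ x in Ioc (τ' j) (τ' (j + 1)), h' x ∂(pathMeasure fun u => S u ω))
    (hm hh τ).aemeasurable (hm hh' τ').aemeasurable).2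
    fun I => ?_
  have hmI := (Finset.measurable_restrict (X := fun _ : ℕ => ℝ) I).comp (hm hh τ)
  have hmI' := (Finset.measurable_restrict (X := fun _ : ℕ => ℝ) I).comp (hm hh' τ')
  refine ⟨hmI.aemeasurable, hmI'.aemeasurable, ?_⟩
  have := Measure.isProbabilityMeasure_map (μ := P) hmI.aemeasurable
  have := Measure.isProbabilityMeasure_map (μ := P) hmI'.aemeasurable
  refine Measure.ext_of_charFunDual (funext fun L => ?_)
  obtain ⟨N, hN⟩ : ∃ N, I ⊆ Finset.range N := I.exists_nat_subset_range
  -- The coefficients of the functional `L` in the standard basis, extended by `0` so that the sum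
  -- runs over an initial segment of `ℕ`.
  let c : ℕ → ℝ := fun j => if hj : j ∈ I then L (Pi.single ⟨j, hj⟩ 1) else 0
  have hL : ∀ y : ℕ → ℝ, L (I.restrict y) = ∑ j ∈ Finset.range N, c j * y j := by
    intro y
    rw [← Finset.sum_subset hN (fun j _ hj => by simp [c, hj]), ← Finset.sum_coe_sort I]
    have : I.restrict y = ∑ j : I, y j • (Pi.single j 1 : I → ℝ) := by
      ext i
      simp [Finset.sum_apply, Pi.single_apply]
    rw [this, map_sum]
    refine Finset.sum_congr rfl fun j _ => ?_
    simp [c, mul_comm]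
  have hcf : ∀ {h : ℝ≥0 → ℝ} (hh : Measurable h) (hi : ∀ T, IntegrableOn h (Ioc 0 T) lebesgue)
      {τ : ℕ → ℝ≥0} (hτ : Monotone τ),
      charFunDual (P.map (I.restrict ∘ fun ω (j : ℕ) =>
        ∫ x in Ioc (τ j) (τ (j + 1)), h x ∂(pathMeasure fun u => S u ω))) L
      = Complex.exp (-∑ j ∈ Finset.range N, ∫ x in Ioc (τ j) (τ (j + 1)),
          Complex.log (1 + (-Complex.I * (c j * h x : ℝ))) ∂lebesgue) := by
    intro h hh hi τ hτ
    rw [charFunDual_apply, integral_map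
      ((Finset.measurable_restrict (X := fun _ : ℕ => ℝ) I).comp (hm hh τ)).aemeasurable
      (Continuous.aestronglyMeasurable (by fun_prop)), ← hS.charFun_sum_integrals hh hi hτ c N]
    congr 1
    ext ω
    rw [Function.comp_apply, hL, mul_comm]
  refine (hcf hh hi hτ).trans (Eq.trans ?_ (hcf hh' hi' hτ').symm)
  congr 2
  refine Finset.sum_congr rfl fun j _ => ?_
  -- Each term integrates a function of `h` alone, so it sees only the distribution of `h` on that
  -- interval.
  exact ((hid j).comp (u := fun y => Complex.log (1 + (-Complex.I * (c j * y : ℝ))))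
    (by fun_prop)).integral_eq

lemma identDistrib_integrals {h h' : ℝ≥0 → ℝ} (hh : Measurable h) (hh' : Measurable h')
    (hi : ∀ T, IntegrableOn h (Ioc 0 T) lebesgue) (hi' : ∀ T, IntegrableOn h' (Ioc 0 T) lebesgue)
    {τ τ' : ℕ → ℝ≥0} (hτ : Monotone τ) (hτ' : Monotone τ')
    (hid : ∀ j, IdentDistrib h h' (lebesgue.restrict (Ioc (τ j) (τ (j + 1))))
      (lebesgue.restrict (Ioc (τ' j) (τ' (j + 1))))) :
    IdentDistrib
      (fun ω (n : ℕ) => ∫ x in Ioc (τ 0) (τ n), h x ∂(pathMeasure fun u => S u ω))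
      (fun ω (n : ℕ) => ∫ x in Ioc (τ' 0) (τ' n), h' x ∂(pathMeasure fun u => S u ω)) P P := by
  have hsum : ∀ {h : ℝ≥0 → ℝ} (hh : Measurable h) (hi : ∀ T, IntegrableOn h (Ioc 0 T) lebesgue)
      {τ : ℕ → ℝ≥0} (hτ : Monotone τ),
      (fun ω (n : ℕ) => ∑ j ∈ Finset.range n,
        ∫ x in Ioc (τ j) (τ (j + 1)), h x ∂(pathMeasure fun u => S u ω)) =ᵐ[P]
      (fun ω (n : ℕ) => ∫ x in Ioc (τ 0) (τ n), h x ∂(pathMeasure fun u => S u ω)) := by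
    intro h hh hi τ hτ
    filter_upwards [hS.ae_forall_integrableOn hh.stronglyMeasurable hi] with ω hω
    ext n
    exact (setIntegral_Ioc_eq_sum hτ n ((hω (τ n)).mono_set (Ioc_subset_Ioc_left bot_le))).symm
  have hu : Measurable fun (y : ℕ → ℝ) (n : ℕ) => ∑ j ∈ Finset.range n, y j := by fun_prop
  have := (hS.identDistrib_increments hh hh' hi hi' hτ hτ' hid).comp hu
  exact ((IdentDistrib.of_ae_eq this.aemeasurable_fst (hsum hh hi hτ)).symm.trans this).trans
    (IdentDistrib.of_ae_eq this.aemeasurable_snd (hsum hh' hi' hτ'))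

end IsRegularGammaProcess

end

/-! ### Calculus of null sequences, uniform in the mode of convergence. -/

section

namespace ConvMode

variable {Ω ι : Type*} [MeasurableSpace Ω] {P : Measure Ω} {m : ConvMode} {l : Filter ι}
  {Z W : ι → Ω → ℝ}

/-- The random variables `Z i` converge to `0` along the filter `l`, in the given mode. -/
def Null (m : ConvMode) (P : Measure Ω) (Z : ι → Ω → ℝ) (l : Filter ι) : Prop :=
  match m with
  | .inProbability => TendstoInMeasure P Z l fun _ => 0
  | .inLp r _ => Tendsto (fun i => eLpNorm (Z i) (r : ℝ≥0∞) P) l (𝓝 0)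
  | .almostSure => ∀ᵐ ω ∂P, Tendsto (fun i => Z i ω) l (𝓝 0)

lemma tendstoOne_iff_null {R : ι → Ω → ℝ} :
    m.TendstoOne P R l ↔ m.Null P (fun i ω => R i ω - 1) l := by
  cases m with
  | inProbability => simp [TendstoOne, Null, tendstoInMeasure_iff_norm]
  | inLp r hr => rfl
  | almostSure =>
    refine ⟨fun h => h.mono fun ω hω => ?_, fun h => h.mono fun ω hω => ?_⟩
    · simpa using hω.sub_const 1
    · simpa using hω.add_const 1

/-- One null set serves all indices at once: almost sure convergence along the uncountable index `t`
requires this. -/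
lemma Null.mono (hW : m.Null P W l) {p : ι → Prop} (hp : ∀ᶠ i in l, p i)
    (h : ∀ᵐ ω ∂P, ∀ i, p i → |Z i ω| ≤ |W i ω|) : m.Null P Z l := by
  cases m with
  | inProbability =>
    simp only [Null, tendstoInMeasure_iff_norm] at hW ⊢
    intro ε hε
    refine tendsto_of_tendsto_of_tendsto_of_le_of_le' tendsto_const_nhds (hW ε hε)
      (Eventually.of_forall fun _ => bot_le) ?_
    filter_upwards [hp] with i hi
    refine measure_mono_ae ?_
    filter_upwards [h] with ω hω
    intro (h1 : ε ≤ ‖Z i ω - 0‖)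
    change ε ≤ ‖W i ω - 0‖
    simp only [sub_zero, Real.norm_eq_abs] at h1 ⊢
    exact h1.trans (hω i hi)
  | inLp r hr =>
    refine tendsto_of_tendsto_of_tendsto_of_le_of_le' tendsto_const_nhds hW
      (Eventually.of_forall fun _ => bot_le) ?_
    filter_upwards [hp] with i hi
    exact eLpNorm_mono_ae (h.mono fun ω hω => hω i hi)
  | almostSure =>
    filter_upwards [h, hW] with ω hω hWω
    refine squeeze_zero_norm' ?_ (tendsto_zero_iff_abs_tendsto_zero _ |>.1 hWω)
    filter_upwards [hp] with i hi using hω i hi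

lemma Null.mono' (hW : m.Null P W l) (h : ∀ᵐ ω ∂P, ∀ i, |Z i ω| ≤ |W i ω|) : m.Null P Z l :=
  hW.mono (p := fun _ => True) (Eventually.of_forall fun _ => trivial)
    (h.mono fun _ hω i _ => hω i)

lemma Null.add (hZ : m.Null P Z l) (hW : m.Null P W l) (mZ : ∀ i, Measurable (Z i))
    (mW : ∀ i, Measurable (W i)) : m.Null P (fun i ω => Z i ω + W i ω) l := by
  cases m with
  | inProbability =>
    simp only [Null, tendstoInMeasure_iff_norm, sub_zero] at hZ hW ⊢
    intro ε hε
    have := (hZ (ε / 2) (half_pos hε)).add (hW (ε / 2) (half_pos hε))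
    rw [add_zero] at this
    refine tendsto_of_tendsto_of_tendsto_of_le_of_le tendsto_const_nhds this
      (fun _ => bot_le) fun i => (measure_mono ?_).trans (measure_union_le _ _)
    intro ω (hω : ε ≤ ‖Z i ω + W i ω‖)
    by_contra hcon
    rw [mem_union, not_or] at hcon
    have h1 : ‖Z i ω‖ < ε / 2 := not_le.1 hcon.1
    have h2 : ‖W i ω‖ < ε / 2 := not_le.1 hcon.2
    linarith [norm_add_le (Z i ω) (W i ω)]
  | inLp r hr =>
    -- For `r < 1` the triangle inequality holds only up to the constant `LpAddConst`.
    have := ENNReal.Tendsto.const_mul (a := ENNReal.LpAddConst r) (Tendsto.add hZ hW)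
      (Or.inr (ENNReal.LpAddConst_lt_top _).ne)
    rw [add_zero, mul_zero] at this
    exact tendsto_of_tendsto_of_tendsto_of_le_of_le tendsto_const_nhds this
      (fun _ => bot_le) fun i => eLpNorm_add_le' (mZ i).aestronglyMeasurable
        (mW i).aestronglyMeasurable _
  | almostSure =>
    filter_upwards [hZ, hW] with ω h1 h2
    simpa using h1.add h2

/-- The form in which squeezes are used: `Z ≤ V ≤ W` implies `|V| ≤ |Z| + |W|`. -/
lemma Null.of_abs_le_add (hZ : m.Null P Z l) (hW : m.Null P W l) (mZ : ∀ i, Measurable (Z i))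
    (mW : ∀ i, Measurable (W i)) {V : ι → Ω → ℝ} {p : ι → Prop} (hp : ∀ᶠ i in l, p i)
    (h : ∀ᵐ ω ∂P, ∀ i, p i → |V i ω| ≤ |Z i ω| + |W i ω|) : m.Null P V l := by
  have hZ' : m.Null P (fun i ω => |Z i ω|) l := hZ.mono' (ae_of_all _ fun ω i => (abs_abs _).le)
  have hW' : m.Null P (fun i ω => |W i ω|) l := hW.mono' (ae_of_all _ fun ω i => (abs_abs _).le)
  refine (hZ'.add hW' (fun i => (mZ i).abs) (fun i => (mW i).abs)).mono hp ?_
  filter_upwards [h] with ω hω i hi using (hω i hi).trans (le_abs_self _)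

lemma Null.const_mul (hZ : m.Null P Z l) (C : ℝ) : m.Null P (fun i ω => C * Z i ω) l := by
  cases m with
  | inProbability =>
    simp only [Null, tendstoInMeasure_iff_norm, sub_zero] at hZ ⊢
    intro ε hε
    have hC : 0 < |C| + 1 := by positivity
    refine tendsto_of_tendsto_of_tendsto_of_le_of_le tendsto_const_nhds
      (hZ (ε / (|C| + 1)) (by positivity)) (fun _ => bot_le) fun i => measure_mono ?_
    intro ω (hω : ε ≤ ‖C * Z i ω‖)
    change ε / (|C| + 1) ≤ ‖Z i ω‖
    rw [div_le_iff₀ hC]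
    rw [norm_mul, Real.norm_eq_abs] at hω
    nlinarith [norm_nonneg (Z i ω)]
  | inLp r hr =>
    have := ENNReal.Tendsto.const_mul (a := ‖C‖ₑ) hZ (Or.inr enorm_ne_top)
    rw [mul_zero] at this
    refine this.congr fun i => ?_
    exact (eLpNorm_const_smul C (Z i) _ P).symm
  | almostSure =>
    filter_upwards [hZ] with ω h1
    simpa using Tendsto.const_mul C h1

lemma Null.bdd_mul (hZ : m.Null P Z l) {c : ι → ℝ} {C : ℝ} (hc : ∀ᶠ i in l, |c i| ≤ C) :
    m.Null P (fun i ω => c i * Z i ω) l := by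
  refine (hZ.const_mul C).mono hc (ae_of_all _ fun ω i hi => ?_)
  rw [abs_mul, abs_mul]
  exact mul_le_mul_of_nonneg_right (hi.trans (le_abs_self _)) (abs_nonneg _)

/-- Disposes of the fixed boundary variables in the squeezes; all moments are required because `r`
is arbitrary. -/
lemma Null.of_tendsto {Y : Ω → ℝ} (hY : ∀ r : ℝ≥0, MemLp Y r P) {c : ι → ℝ}
    (hc : Tendsto c l (𝓝 0)) : m.Null P (fun i ω => c i * Y ω) l := by
  have hLp : ∀ r : ℝ≥0, Tendsto (fun i => eLpNorm (fun ω => c i * Y ω) (r : ℝ≥0∞) P) l (𝓝 0) := by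
    intro r
    have h1 : Tendsto (fun i => ‖c i‖ₑ) l (𝓝 0) := by simpa using hc.enorm
    have := ENNReal.Tendsto.mul_const (b := eLpNorm Y r P) h1 (Or.inr (hY r).2.ne)
    rw [zero_mul] at this
    refine this.congr fun i => ?_
    exact (eLpNorm_const_smul (c i) Y _ P).symm
  cases m with
  | inProbability =>
    refine tendstoInMeasure_of_tendsto_eLpNorm (p := 1) one_ne_zero
      (fun i => (hY 1).1.const_mul _) aestronglyMeasurable_const ?_
    refine (hLp 1).congr fun i => ?_
    congr 1
    ext ω
    simp
  | inLp r hr => exact hLp r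
  | almostSure =>
    refine ae_of_all _ fun ω => ?_
    simpa using hc.mul_const (Y ω)

lemma Null.of_tendsto_const [IsProbabilityMeasure P] {c : ι → ℝ} (hc : Tendsto c l (𝓝 0)) :
    m.Null P (fun i _ => c i) l := by
  simpa using Null.of_tendsto (P := P) (m := m) (Y := fun _ => 1) (fun r => memLp_const 1) hc

/-- Change of normalizer: if `Z = X / a - 1` and `c = a / b`, then `c Z + (c - 1) = X / b - 1`. -/
lemma Null.affine [IsProbabilityMeasure P] (hZ : m.Null P Z l) {c : ι → ℝ}
    (hc : Tendsto c l (𝓝 1)) (mZ : ∀ i, Measurable (Z i)) :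
    m.Null P (fun i ω => c i * Z i ω + (c i - 1)) l := by
  refine (hZ.bdd_mul (C := 2) ?_).add (.of_tendsto_const (by simpa using hc.sub_const 1))
    (fun i => (mZ _).const_mul _) (fun i => measurable_const)
  filter_upwards [hc.abs.eventually (gt_mem_nhds (show |(1 : ℝ)| < 2 by norm_num))] with i hi
  exact hi.le

lemma Null.comp {ι' : Type*} {l' : Filter ι'} (hZ : m.Null P Z l) {φ : ι' → ι}
    (hφ : Tendsto φ l' l) : m.Null P (fun i => Z (φ i)) l' := by
  cases m with
  | inProbability => exact fun ε hε => (hZ ε hε).comp hφ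
  | inLp r hr =>
    have h : Tendsto (fun i => eLpNorm (Z i) (r : ℝ≥0∞) P) l (𝓝 0) := hZ
    exact h.comp hφ
  | almostSure =>
    have h : ∀ᵐ ω ∂P, Tendsto (fun i => Z i ω) l (𝓝 0) := hZ
    exact h.mono fun ω hω => hω.comp hφ

lemma null_succ_iff {Z : ℕ → Ω → ℝ} :
    m.Null P (fun n => Z (n + 1)) atTop ↔ m.Null P Z atTop := by
  refine ⟨fun h => ?_, fun h => h.comp (tendsto_add_atTop_nat 1)⟩
  refine (h.comp (tendsto_sub_atTop_nat 1)).mono (eventually_ge_atTop 1) (ae_of_all _ ?_)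
  intro ω n hn
  rw [Nat.sub_add_cancel hn]

lemma Null.inProbability [IsFiniteMeasure P] {Z : ℕ → Ω → ℝ} (hZ : m.Null P Z atTop)
    (mZ : ∀ i, Measurable (Z i)) : ConvMode.inProbability.Null P Z atTop := by
  cases m with
  | inProbability => exact hZ
  | inLp r hr =>
    refine tendstoInMeasure_of_tendsto_eLpNorm (p := r) (by exact_mod_cast hr.ne')
      (fun i => (mZ i).aestronglyMeasurable) aestronglyMeasurable_const ?_
    refine Tendsto.congr (fun i => ?_) hZ
    congr 1
    ext ω
    simp
  | almostSure =>
    exact tendstoInMeasure_of_tendsto_ae (fun i => (mZ i).aestronglyMeasurable) hZ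

/-- Marginal laws suffice for convergence in probability and in `L^r`; the almost sure mode uses the
law of the whole sequence. -/
lemma Null.of_identDistrib {Z W : ℕ → Ω → ℝ}
    (h : IdentDistrib (fun ω n => Z n ω) (fun ω n => W n ω) P P) (hZ : m.Null P Z atTop) :
    m.Null P W atTop := by
  have hn : ∀ n, IdentDistrib (Z n) (W n) P P := fun n => h.comp (measurable_pi_apply n)
  cases m with
  | inProbability =>
    simp only [Null, tendstoInMeasure_iff_norm, sub_zero] at hZ ⊢
    intro ε hε
    refine (hZ ε hε).congr fun n => ?_
    exact (hn n).measure_mem_eq (s := {x : ℝ | ε ≤ ‖x‖})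
      (measurableSet_le measurable_const measurable_norm)
  | inLp r hr =>
    refine Tendsto.congr (fun n => ?_) hZ
    exact (hn n).eLpNorm_eq _
  | almostSure =>
    exact h.ae_snd (p := fun x : ℕ → ℝ => Tendsto x atTop (𝓝 0))
      (measurableSet_tendsto _ fun n => measurable_pi_apply n) hZ

lemma TendstoOne.congr {R R' : ι → Ω → ℝ} (h : ∀ᵐ ω ∂P, ∀ i, R i ω = R' i ω) :
    m.TendstoOne P R l ↔ m.TendstoOne P R' l := by
  rw [tendstoOne_iff_null, tendstoOne_iff_null]
  constructor <;> intro hR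
  · exact hR.mono' (h.mono fun ω hω i => by rw [hω i])
  · exact hR.mono' (h.mono fun ω hω i => by rw [hω i])

end ConvMode

end

/-! ### Negligibility of the last interval; passage from the nodes to all times. -/

section

lemma tendsto_node_atTop (p : ℝ≥0) {q : ℝ≥0} (hq : 0 < q) : Tendsto (node p q) atTop atTop := by
  refine tendsto_atTop_mono (fun n => le_add_of_nonneg_left (zero_le)) ?_
  exact tendsto_natCast_atTop_atTop.const_mul_atTop hq

section cumul

variable {h : ℝ≥0 → ℝ}

lemma cumul_mono (h0 : ∀ x, 0 ≤ h x) (hi : ∀ T, IntegrableOn h (Ioc 0 T) lebesgue) :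
    Monotone (cumul h) := fun _ t hst =>
  setIntegral_mono_set (hi t) (ae_of_all _ h0) (Ioc_subset_Ioc_right hst).eventuallyLE

lemma cumul_sub_cumul (hi : ∀ T, IntegrableOn h (Ioc 0 T) lebesgue) {s t : ℝ≥0} (hst : s ≤ t) :
    cumul h t - cumul h s = ∫ x in Ioc s t, h x ∂lebesgue := by
  rw [sub_eq_iff_eq_add', cumul, cumul, ← setIntegral_union (Ioc_disjoint_Ioc_of_le le_rfl)
    measurableSet_Ioc (hi s) ((hi t).mono_set (Ioc_subset_Ioc_left bot_le)),
    Ioc_union_Ioc_eq_Ioc (show (0 : ℝ≥0) ≤ s from bot_le) hst]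

end cumul

lemma log_one_add_le_self {u : ℝ} (hu : 0 ≤ u) : Real.log (1 + u) ≤ u := by
  have := Real.log_le_sub_one_of_pos (show 0 < 1 + u by linarith)
  linarith

/-- By concavity `log(1 + u)` lies below its tangent at `δ`, and `log(1 + δ) ≤ δ`; hence `u - log(1
+ u) ≥ (u - δ) δ / (1 + δ)`. -/
lemma le_add_mul_sub_log {u δ : ℝ} (hu : 0 ≤ u) (hδ : 0 < δ) :
    u ≤ δ + (1 + δ) / δ * (u - Real.log (1 + u)) := by
  have h1 : Real.log (1 + u) ≤ δ + (u - δ) / (1 + δ) := by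
    have h2 : (1 + u) = (1 + δ) * ((1 + u) / (1 + δ)) := by field_simp
    rw [h2, Real.log_mul (by positivity) (by positivity)]
    have h3 := Real.log_le_sub_one_of_pos (show 0 < (1 + u) / (1 + δ) by positivity)
    have h4 := log_one_add_le_self hδ.le
    have h5 : (1 + u) / (1 + δ) - 1 = (u - δ) / (1 + δ) := by field_simp; ring
    linarith
  have h6 : (1 + δ) / δ * (u - (δ + (u - δ) / (1 + δ))) = u - δ := by field_simp; ring
  have h7 : (1 + δ) / δ * (u - (δ + (u - δ) / (1 + δ)))
      ≤ (1 + δ) / δ * (u - Real.log (1 + u)) := by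
    have : 0 ≤ (1 + δ) / δ := by positivity
    gcongr
  linarith

variable {Ω : Type*} [MeasurableSpace Ω] {P : Measure Ω} {S : ℝ≥0 → Ω → ℝ}

lemma tendsto_integral_exp_neg [IsProbabilityMeasure P] {R : ℕ → Ω → ℝ} (hm : ∀ n, Measurable (R n))
    (h0 : ∀ n ω, 0 ≤ R n ω) (hR : TendstoInMeasure P R atTop fun _ => 1) :
    Tendsto (fun n => ∫ ω, Real.exp (-R n ω) ∂P) atTop (𝓝 (Real.exp (-1))) := by
  refine tendsto_of_subseq_tendsto fun ns hns => ?_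
  obtain ⟨ms, -, hms⟩ := (hR.comp hns).exists_seq_tendsto_ae
  refine ⟨ms, ?_⟩
  have : Real.exp (-1) = ∫ _, Real.exp (-1) ∂P := by simp
  rw [this]
  refine tendsto_integral_of_dominated_convergence (fun _ => 1)
    (fun n => (hm _).neg.exp.aestronglyMeasurable) (integrable_const _)
    (fun n => ae_of_all _ fun ω => ?_) ?_
  · rw [Real.norm_eq_abs, Real.abs_exp]
    exact Real.exp_le_one_iff.2 (neg_nonpos.2 (h0 _ _))
  · filter_upwards [hms] with ω hω
    exact (Real.continuous_exp.tendsto _).comp hω.neg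

namespace IsRegularGammaProcess

variable (hS : IsRegularGammaProcess S P) {h : ℝ≥0 → ℝ} (hh : Measurable h) (h0 : ∀ x, 0 ≤ h x)
  (hi : ∀ T, IntegrableOn h (Ioc 0 T) lebesgue)
include hS hh

lemma measurable_gammaIntegral (T : ℝ≥0) : Measurable (gammaIntegral S h T) :=
  hS.measurable_setIntegral_Ioc hh 0 T

lemma measurable_gammaRatio (T : ℝ≥0) : Measurable (gammaRatio S h T) :=
  (hS.measurable_gammaIntegral hh T).div_const _

include h0 hi

lemma ae_monotone_gammaIntegral : ∀ᵐ ω ∂P, Monotone fun t => gammaIntegral S h t ω := by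
  filter_upwards [hS.ae_forall_integrableOn hh.stronglyMeasurable hi] with ω hω s t hst
  exact setIntegral_mono_set (hω t) (ae_of_all _ h0) (Ioc_subset_Ioc_right hst).eventuallyLE

variable [IsProbabilityMeasure P]

lemma laplace_real (T : ℝ≥0) {c : ℝ} (hc : 0 ≤ c) :
    ∫ ω, Real.exp (-(c * gammaIntegral S h T ω)) ∂P
      = Real.exp (-∫ x in Ioc 0 T, Real.log (1 + c * h x) ∂lebesgue) := by
  have hlog : ∀ x, Complex.log (1 + ((c * h x : ℝ) : ℂ)) = (Real.log (1 + c * h x) : ℝ) := by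
    intro x
    rw [Complex.ofReal_log (by have := mul_nonneg hc (h0 x); linarith)]
    push_cast
    rfl
  have key := hS.laplace (T := T) (k := fun x => ((c * h x : ℝ) : ℂ)) (by fun_prop)
    (((hi T).const_mul c).ofReal) (fun x => by
      rw [Complex.ofReal_re]; exact mul_nonneg hc (h0 x))
  simp only [hlog, integral_complex_ofReal, integral_const_mul, ← Complex.ofReal_neg,
    ← Complex.ofReal_exp] at key
  exact_mod_cast key

/-- If `R_{t_n} → 1` in probability then the mass of the last interval is asymptotically
negligible. -/
lemma tendsto_increment_div {p q : ℝ≥0} (hdiv : Tendsto (fun n => cumul h (node p q n)) atTop atTop)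
    (hR : ConvMode.inProbability.TendstoOne P (fun n : ℕ => gammaRatio S h (node p q n)) atTop) :
    Tendsto (fun n => (cumul h (node p q (n + 1)) - cumul h (node p q n))
      / cumul h (node p q (n + 1))) atTop (𝓝 0) := by
  set L : ℕ → ℝ := fun n => cumul h (node p q n) with hL
  have hmono : Monotone L := (cumul_mono h0 hi).comp (node_mono p q)
  have hLnn : ∀ n, 0 ≤ L n := fun n => integral_nonneg h0
  -- By the Laplace functional `E exp(-R_{t_n}) = exp(-I n)`, so convergence in probability gives `I
  -- n → 1`.
  let I : ℕ → ℝ := fun n => ∫ x in Ioc 0 (node p q n), Real.log (1 + (L n)⁻¹ * h x) ∂lebesgue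
  have hI : Tendsto I atTop (𝓝 1) := by
    have h1 := tendsto_integral_exp_neg (fun n => hS.measurable_gammaRatio hh (node p q n))
      (fun n ω => div_nonneg (integral_nonneg h0) (hLnn n)) hR
    have h2 : ∀ n, ∫ ω, Real.exp (-gammaRatio S h (node p q n) ω) ∂P = Real.exp (-I n) := by
      intro n
      rw [← hS.laplace_real hh h0 hi (node p q n) (inv_nonneg.2 (hLnn n))]
      simp only [gammaRatio, div_eq_inv_mul, hL]
    simp only [h2] at h1
    have h3 := ((Real.continuousAt_log (Real.exp_pos (-1)).ne').tendsto.comp h1).neg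
    simpa [Function.comp_def] using h3
  have hu0 : ∀ n x, 0 ≤ (L n)⁻¹ * h x := fun n x => mul_nonneg (inv_nonneg.2 (hLnn n)) (h0 x)
  have hui : ∀ n T, IntegrableOn (fun x => (L n)⁻¹ * h x) (Ioc 0 T) lebesgue := fun n T =>
    (hi T).const_mul _
  have hli : ∀ n T, IntegrableOn (fun x => Real.log (1 + (L n)⁻¹ * h x)) (Ioc 0 T) lebesgue := by
    intro n T
    refine Integrable.mono (hui n T)
      ((hh.const_mul _).const_add 1).log.aestronglyMeasurable (ae_of_all _ fun x => ?_)
    have := hu0 n x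
    rw [Real.norm_of_nonneg this, Real.norm_of_nonneg (Real.log_nonneg (by linarith))]
    exact log_one_add_le_self this
  -- `le_add_mul_sub_log` is integrated over the last interval, of length `q`. The defect `u - log(1
  -- + u)` is nonnegative, so its integral may be enlarged to `(0, t_{n+1}]`, where it equals `1 - I
  -- (n + 1)`.
  have bound : ∀ δ : ℝ, 0 < δ → ∀ n, 0 < L (n + 1) →
      (L (n + 1) - L n) / L (n + 1) ≤ δ * q + (1 + δ) / δ * (1 - I (n + 1)) := by
    intro δ hδ n hn
    have hst := node_mono p q (Nat.le_succ n)
    have hsub : Ioc (node p q n) (node p q (n + 1)) ⊆ Ioc 0 (node p q (n + 1)) :=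
      Ioc_subset_Ioc_left bot_le
    have e1 : (L (n + 1) - L n) / L (n + 1)
        = ∫ x in Ioc (node p q n) (node p q (n + 1)), (L (n + 1))⁻¹ * h x ∂lebesgue := by
      rw [integral_const_mul, ← cumul_sub_cumul hi hst, div_eq_inv_mul]
    have hψ : IntegrableOn (fun x => (L (n + 1))⁻¹ * h x - Real.log (1 + (L (n + 1))⁻¹ * h x))
        (Ioc 0 (node p q (n + 1))) lebesgue := (hui _ _).sub (hli _ _)
    have e2 : ∫ x in Ioc 0 (node p q (n + 1)),
        ((L (n + 1))⁻¹ * h x - Real.log (1 + (L (n + 1))⁻¹ * h x)) ∂lebesgue = 1 - I (n + 1) := by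
      rw [integral_sub (hui _ _) (hli _ _), integral_const_mul]
      change (L (n + 1))⁻¹ * L (n + 1) - _ = _
      rw [inv_mul_cancel₀ hn.ne']
    have e3 : ∫ x in Ioc (node p q n) (node p q (n + 1)), (δ + (1 + δ) / δ *
        ((L (n + 1))⁻¹ * h x - Real.log (1 + (L (n + 1))⁻¹ * h x))) ∂lebesgue
        = δ * q + (1 + δ) / δ * ∫ x in Ioc (node p q n) (node p q (n + 1)),
          ((L (n + 1))⁻¹ * h x - Real.log (1 + (L (n + 1))⁻¹ * h x)) ∂lebesgue := by
      rw [integral_add (integrable_const _) ((hψ.mono_set hsub).const_mul _), setIntegral_const,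
        lebesgue_real_Ioc hst, node_succ_sub, integral_const_mul, smul_eq_mul, mul_comm δ]
    rw [e1, ← e2]
    refine (integral_mono ((hui _ _).mono_set hsub)
      ((integrable_const δ).add ((hψ.mono_set hsub).const_mul ((1 + δ) / δ)))
      fun x => le_add_mul_sub_log (hu0 _ x) hδ).trans ?_
    refine e3.le.trans ?_
    have : 0 ≤ (1 + δ) / δ := by positivity
    gcongr
    exact ae_of_all _ fun x => sub_nonneg.2 (log_one_add_le_self (hu0 _ x))
  rw [Metric.tendsto_atTop]
  intro ε hε
  let δ : ℝ := ε / (2 * (q + 1))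
  have hδ : 0 < δ := by positivity
  have hδq : δ * q < ε / 2 + 0 := by
    have : δ * (q + 1) = ε / 2 := by simp only [δ]; field_simp
    nlinarith
  have hlim : Tendsto (fun n => δ * q + (1 + δ) / δ * (1 - I (n + 1))) atTop (𝓝 (δ * q)) := by
    have := (((tendsto_add_atTop_iff_nat 1).2 hI).const_sub 1).const_mul ((1 + δ) / δ)
    simpa using this.const_add (δ * q)
  have hev := hlim.eventually (gt_mem_nhds (show δ * q < ε by linarith))
  have hpos := ((tendsto_add_atTop_iff_nat 1).2 hdiv).eventually (eventually_gt_atTop 0)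
  obtain ⟨N, hN⟩ := eventually_atTop.1 (hev.and hpos)
  refine ⟨N, fun n hn => ?_⟩
  obtain ⟨h1, h2⟩ := hN n hn
  have h3 : 0 ≤ (L (n + 1) - L n) / L (n + 1) :=
    div_nonneg (sub_nonneg.2 (hmono (Nat.le_succ n))) h2.le
  rw [Real.dist_eq, sub_zero, abs_of_nonneg h3]
  exact (bound δ hδ n h2).trans_lt h1

lemma tendsto_cumul_ratio {p q : ℝ≥0} (hdiv : Tendsto (fun n => cumul h (node p q n)) atTop atTop)
    (hR : ConvMode.inProbability.TendstoOne P (fun n : ℕ => gammaRatio S h (node p q n)) atTop) :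
    Tendsto (fun n => cumul h (node p q n) / cumul h (node p q (n + 1))) atTop (𝓝 1) := by
  have := (hS.tendsto_increment_div hh h0 hi hdiv hR).const_sub 1
  rw [sub_zero] at this
  refine this.congr' ?_
  filter_upwards [((tendsto_add_atTop_iff_nat 1).2 hdiv).eventually (eventually_gt_atTop 0)]
    with n hn
  have : cumul h (node p q (n + 1)) ≠ 0 := ne_of_gt hn
  field_simp
  ring

omit hi h0 in
lemma tendstoOne_inProbability {m : ConvMode} {p q : ℝ≥0}
    (hR : OrderlyDivergenceAlong m P S h p q) :
    OrderlyDivergenceAlong .inProbability P S h p q := by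
  rw [OrderlyDivergenceAlong, ConvMode.tendstoOne_iff_null] at hR ⊢
  exact hR.inProbability fun n => (hS.measurable_gammaRatio hh _).sub_const 1

/-- For `t_n ≤ t ≤ t_{n+1}`, with `a` and `b` the values of `λ h` at these nodes, `S_{t_n} h / b ≤
R_t ≤ S_{t_{n+1}} h / a`, and `a / b → 1`. Monotonicity of `h` plays no role, so the result also
covers rearrangements. -/
theorem orderlyDivergence_iff_along {m : ConvMode} (p : ℝ≥0) {q : ℝ≥0} (hq : 0 < q)
    (hdiv : Tendsto (cumul h) atTop atTop) :
    OrderlyDivergence m P S h ↔ OrderlyDivergenceAlong m P S h p q := by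
  have hnode := tendsto_node_atTop p hq
  constructor
  · intro hR
    rw [OrderlyDivergence, ConvMode.tendstoOne_iff_null] at hR
    rw [OrderlyDivergenceAlong, ConvMode.tendstoOne_iff_null]
    exact hR.comp hnode
  · intro hR
    have hdivn := hdiv.comp hnode
    have hρ := hS.tendsto_cumul_ratio hh h0 hi hdivn (hS.tendstoOne_inProbability hh hR)
    rw [OrderlyDivergenceAlong, ConvMode.tendstoOne_iff_null] at hR
    rw [OrderlyDivergence, ConvMode.tendstoOne_iff_null]
    set L : ℕ → ℝ := fun n => cumul h (node p q n) with hL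
    have hρ' : Tendsto (fun n => L (n + 1) / L n) atTop (𝓝 1) := by
      simpa using hρ.inv₀ one_ne_zero
    have mR : ∀ n, Measurable fun ω => gammaRatio S h (node p q n) ω - 1 := fun n =>
      (hS.measurable_gammaRatio hh _).sub_const 1
    -- The index of the last node before `t`; truncated subtraction makes it `0` for `t < p`.
    let ν : ℝ≥0 → ℕ := fun t => ⌊(t - p) / q⌋₊
    have hν : Tendsto ν atTop atTop := by
      refine tendsto_nat_floor_atTop.comp (Tendsto.atTop_div_const hq ?_)
      refine tendsto_atTop.2 fun b => ?_
      filter_upwards [eventually_ge_atTop (b + p)] with t ht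
      exact le_tsub_of_add_le_right ht
    have hup := ((hR.comp (tendsto_add_atTop_nat 1)).affine hρ' (fun n => mR _)).comp hν
    have hlo := (hR.affine hρ mR).comp hν
    have hp : ∀ᶠ t in atTop, p ≤ t ∧ 0 < L (ν t) :=
      (eventually_ge_atTop p).and ((hdivn.comp hν).eventually (eventually_gt_atTop 0))
    refine hup.of_abs_le_add hlo (fun t => ((mR _).const_mul _).add_const _)
      (fun t => ((mR _).const_mul _).add_const _) hp ?_
    filter_upwards [hS.ae_monotone_gammaIntegral hh h0 hi] with ω hω t ht
    obtain ⟨hpt, hLt⟩ := ht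
    have ht1 : node p q (ν t) ≤ t := by
      have := Nat.floor_le (show 0 ≤ (t - p) / q from bot_le)
      rw [le_div_iff₀ hq, le_tsub_iff_left hpt, mul_comm] at this
      exact this
    have ht2 : t ≤ node p q (ν t + 1) := by
      have := (Nat.lt_floor_add_one ((t - p) / q)).le
      rw [div_le_iff₀ hq, tsub_le_iff_left, mul_comm] at this
      unfold node
      exact_mod_cast this
    have c1 := cumul_mono h0 hi ht1
    have c2 := cumul_mono h0 hi ht2
    have g1 := hω ht1
    have g2 := hω ht2
    have gn : 0 ≤ gammaIntegral S h (node p q (ν t)) ω := integral_nonneg h0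
    simp only [gammaRatio, hL] at c1 c2 g1 g2 hLt ⊢
    generalize ν t = n at *
    set a := cumul h (node p q n)
    set b := cumul h (node p q (n + 1))
    have hb : 0 < b := by linarith
    have hct : 0 < cumul h t := by linarith
    have e1 : b / a * (gammaIntegral S h (node p q (n + 1)) ω / b - 1) + (b / a - 1)
        = gammaIntegral S h (node p q (n + 1)) ω / a - 1 := by field_simp; ring
    have e2 : a / b * (gammaIntegral S h (node p q n) ω / a - 1) + (a / b - 1)
        = gammaIntegral S h (node p q n) ω / b - 1 := by field_simp; ring
    rw [e1, e2]
    have u : gammaIntegral S h t ω / cumul h t ≤ gammaIntegral S h (node p q (n + 1)) ω / a := by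
      have : 0 ≤ gammaIntegral S h (node p q (n + 1)) ω := by linarith
      gcongr
    have v : gammaIntegral S h (node p q n) ω / b ≤ gammaIntegral S h t ω / cumul h t := by
      have : 0 ≤ gammaIntegral S h t ω := by linarith
      gcongr
    rw [abs_le]
    constructor
    · linarith [neg_abs_le (gammaIntegral S h (node p q n) ω / b - 1),
        abs_nonneg (gammaIntegral S h (node p q (n + 1)) ω / a - 1)]
    · linarith [le_abs_self (gammaIntegral S h (node p q (n + 1)) ω / a - 1),
        abs_nonneg (gammaIntegral S h (node p q n) ω / b - 1)]

end IsRegularGammaProcess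

end

/-! ### One-sided squeezes and interval bounds for monotonic integrands. -/

section

section Squeeze

variable {Ω : Type*} [MeasurableSpace Ω] {P : Measure Ω} [IsProbabilityMeasure P] {m : ConvMode}
  {σ F G : ℕ → Ω → ℝ} {Y : Ω → ℝ} {ℓ α β : ℕ → ℝ}

/-- Only the negative part of the deviation of the lower bound `F` and the positive part of that of
the upper bound `G` are needed. The opposite parts are what `null_max_of_le` and `null_min_of_le`
recover from `σ`. -/
lemma null_of_squeeze (hF : ∀ n ω, F n ω ≤ σ n ω) (hG : ∀ n ω, σ n ω ≤ G n ω + Y ω)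
    (mF : ∀ n, Measurable (F n)) (mG : ∀ n, Measurable (G n)) (mY : Measurable Y)
    (hY : ∀ r : ℝ≥0, MemLp Y r P) (hℓ : Tendsto ℓ atTop atTop)
    (hα : Tendsto (fun n => α n / ℓ n) atTop (𝓝 1)) (hβ : Tendsto (fun n => β n / ℓ n) atTop (𝓝 1))
    (hα0 : ∀ᶠ n in atTop, 0 < α n) (hβ0 : ∀ᶠ n in atTop, 0 < β n)
    (hFn : m.Null P (fun n ω => min (F n ω / α n - 1) 0) atTop)
    (hGn : m.Null P (fun n ω => max (G n ω / β n - 1) 0) atTop) :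
    m.Null P (fun n ω => σ n ω / ℓ n - 1) atTop := by
  have mF' : ∀ n, Measurable fun ω => min (F n ω / α n - 1) 0 := fun n =>
    (((mF n).div_const _).sub_const 1).min measurable_const
  have mG' : ∀ n, Measurable fun ω => max (G n ω / β n - 1) 0 := fun n =>
    (((mG n).div_const _).sub_const 1).max measurable_const
  have hlo := hFn.affine hα mF'
  have hup := (hGn.affine hβ mG').add (ConvMode.Null.of_tendsto hY hℓ.inv_tendsto_atTop)
    (fun n => ((mG' n).const_mul _).add_const _) (fun n => mY.const_mul _)
  refine hlo.of_abs_le_add hup (fun n => ((mF' n).const_mul _).add_const _)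
    (fun n => (((mG' n).const_mul _).add_const _).add (mY.const_mul _))
    ((hℓ.eventually (eventually_gt_atTop 0)).and (hα0.and hβ0)) (ae_of_all _ ?_)
  rintro ω n ⟨h1, h2, h3⟩
  have e1 : α n / ℓ n * min (F n ω / α n - 1) 0 + (α n / ℓ n - 1) ≤ σ n ω / ℓ n - 1 := by
    have : α n / ℓ n * min (F n ω / α n - 1) 0 ≤ α n / ℓ n * (F n ω / α n - 1) := by
      gcongr; exact min_le_left _ _
    have h4 : α n / ℓ n * (F n ω / α n - 1) + (α n / ℓ n - 1) = F n ω / ℓ n - 1 := by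
      field_simp; ring
    have h5 : F n ω / ℓ n ≤ σ n ω / ℓ n := by gcongr; exact hF n ω
    linarith
  have e2 : σ n ω / ℓ n - 1
      ≤ β n / ℓ n * max (G n ω / β n - 1) 0 + (β n / ℓ n - 1) + ℓ⁻¹ n * Y ω := by
    have : β n / ℓ n * (G n ω / β n - 1) ≤ β n / ℓ n * max (G n ω / β n - 1) 0 := by
      gcongr; exact le_max_left _ _
    have h4 : β n / ℓ n * (G n ω / β n - 1) + (β n / ℓ n - 1) + ℓ⁻¹ n * Y ω
        = (G n ω + Y ω) / ℓ n - 1 := by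
      rw [Pi.inv_apply]; field_simp; ring
    have h5 : σ n ω / ℓ n ≤ (G n ω + Y ω) / ℓ n := by gcongr; exact hG n ω
    linarith
  rw [abs_le]
  constructor
  · linarith [neg_abs_le (α n / ℓ n * min (F n ω / α n - 1) 0 + (α n / ℓ n - 1)),
      abs_nonneg (β n / ℓ n * max (G n ω / β n - 1) 0 + (β n / ℓ n - 1) + ℓ⁻¹ n * Y ω)]
  · linarith [le_abs_self (β n / ℓ n * max (G n ω / β n - 1) 0 + (β n / ℓ n - 1) + ℓ⁻¹ n * Y ω),
      abs_nonneg (α n / ℓ n * min (F n ω / α n - 1) 0 + (α n / ℓ n - 1))]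

lemma null_max_of_le (hF : ∀ n ω, F n ω ≤ σ n ω) (mσ : ∀ n, Measurable (σ n))
    (hα : Tendsto (fun n => α n / ℓ n) atTop (𝓝 1))
    (hα0 : ∀ᶠ n in atTop, 0 < α n) (hℓ0 : ∀ᶠ n in atTop, 0 < ℓ n)
    (hσ : m.Null P (fun n ω => σ n ω / ℓ n - 1) atTop) :
    m.Null P (fun n ω => max (F n ω / α n - 1) 0) atTop := by
  have hα' : Tendsto (fun n => ℓ n / α n) atTop (𝓝 1) := by simpa using hα.inv₀ one_ne_zero
  refine (hσ.affine hα' fun n => ((mσ n).div_const _).sub_const 1).mono (hα0.and hℓ0)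
    (ae_of_all _ ?_)
  rintro ω n ⟨h1, h2⟩
  have h4 : ℓ n / α n * (σ n ω / ℓ n - 1) + (ℓ n / α n - 1) = σ n ω / α n - 1 := by
    field_simp; ring
  have h5 : F n ω / α n ≤ σ n ω / α n := by gcongr; exact hF n ω
  rw [h4, abs_of_nonneg (le_max_right _ _)]
  exact max_le (le_trans (by linarith) (le_abs_self _)) (abs_nonneg _)

lemma null_min_of_le (hG : ∀ n ω, σ n ω ≤ G n ω + Y ω) (mσ : ∀ n, Measurable (σ n))
    (mY : Measurable Y) (hY : ∀ r : ℝ≥0, MemLp Y r P)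
    (hβ : Tendsto (fun n => β n / ℓ n) atTop (𝓝 1))
    (hβ0 : Tendsto β atTop atTop) (hℓ0 : ∀ᶠ n in atTop, 0 < ℓ n)
    (hσ : m.Null P (fun n ω => σ n ω / ℓ n - 1) atTop) :
    m.Null P (fun n ω => min (G n ω / β n - 1) 0) atTop := by
  have hβ' : Tendsto (fun n => ℓ n / β n) atTop (𝓝 1) := by simpa using hβ.inv₀ one_ne_zero
  have mσ' : ∀ n, Measurable fun ω => σ n ω / ℓ n - 1 := fun n =>
    ((mσ n).div_const _).sub_const 1
  refine ((hσ.affine hβ' mσ').of_abs_le_add (ConvMode.Null.of_tendsto hY hβ0.inv_tendsto_atTop)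
    (fun n => ((mσ' n).const_mul _).add_const _) (fun n => mY.const_mul _))
    ((hβ0.eventually (eventually_gt_atTop 0)).and hℓ0) (ae_of_all _ ?_)
  rintro ω n ⟨h1, h2⟩
  have h4 : ℓ n / β n * (σ n ω / ℓ n - 1) + (ℓ n / β n - 1) = σ n ω / β n - 1 := by
    field_simp; ring
  have h5 : σ n ω / β n ≤ (G n ω + Y ω) / β n := by gcongr; exact hG n ω
  have h6 : β⁻¹ n * Y ω = Y ω / β n := by rw [Pi.inv_apply, div_eq_inv_mul]
  rw [h4, h6, abs_of_nonpos (min_le_right _ _), neg_le, le_min_iff]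
  rw [add_div] at h5
  constructor
  · linarith [neg_abs_le (σ n ω / β n - 1), le_abs_self (Y ω / β n)]
  · linarith [abs_nonneg (σ n ω / β n - 1), abs_nonneg (Y ω / β n)]

omit [IsProbabilityMeasure P] in
lemma null_iff_max_min (mσ : ∀ n, Measurable (σ n)) :
    m.Null P σ atTop ↔ m.Null P (fun n ω => max (σ n ω) 0) atTop ∧
      m.Null P (fun n ω => min (σ n ω) 0) atTop := by
  refine ⟨fun h => ⟨h.mono' (ae_of_all _ fun ω n => ?_), h.mono' (ae_of_all _ fun ω n => ?_)⟩,
    fun ⟨h1, h2⟩ => h1.of_abs_le_add h2 (fun n => (mσ n).max measurable_const)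
      (fun n => (mσ n).min measurable_const) (p := fun _ => True)
      (Eventually.of_forall fun _ => trivial) (ae_of_all _ fun ω n _ => ?_)⟩
  · rcases le_total (σ n ω) 0 with h | h <;> simp [h]
  · rcases le_total (σ n ω) 0 with h | h <;> simp [h]
  · rcases le_total (σ n ω) 0 with h | h <;> simp [h]

end Squeeze

section Bounds

variable {f : ℝ≥0 → ℝ} {μ : Measure ℝ≥0}

lemma measurable_of_monotone_or_antitone (hf : Monotone f ∨ Antitone f) : Measurable f :=
  hf.elim Monotone.measurable Antitone.measurable

lemma le_add_of_monotone_or_antitone (hf : Monotone f ∨ Antitone f) (h0 : ∀ x, 0 ≤ f x)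
    {x T : ℝ≥0} (hx : x ≤ T) : f x ≤ f 0 + f T := by
  rcases hf with hf | hf
  · linarith [hf hx, h0 0]
  · linarith [hf (show 0 ≤ x from bot_le), h0 T]

lemma integrableOn_of_monotone_or_antitone (hf : Monotone f ∨ Antitone f) (h0 : ∀ x, 0 ≤ f x)
    (hμ : ∀ a b, IsFiniteMeasure (μ.restrict (Ioc a b))) (T : ℝ≥0) :
    IntegrableOn f (Ioc 0 T) μ := by
  have := hμ 0 T
  refine Integrable.of_bound (measurable_of_monotone_or_antitone hf).aestronglyMeasurable
    (f 0 + f T) ?_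
  filter_upwards [ae_restrict_mem measurableSet_Ioc] with x hx
  rw [Real.norm_of_nonneg (h0 x)]
  exact le_add_of_monotone_or_antitone hf h0 hx.2

lemma setIntegral_Ioc_bounds (hμ : ∀ a b, IsFiniteMeasure (μ.restrict (Ioc a b)))
    (hi : ∀ T, IntegrableOn f (Ioc 0 T) μ) {τ : ℕ → ℝ≥0} (hτ : Monotone τ) {u v : ℕ → ℝ}
    (huv : ∀ j, ∀ x ∈ Ioc (τ j) (τ (j + 1)), u j ≤ f x ∧ f x ≤ v j) (n : ℕ) :
    ∑ j ∈ Finset.range n, u j * μ.real (Ioc (τ j) (τ (j + 1))) ≤ ∫ x in Ioc (τ 0) (τ n), f x ∂μ ∧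
    ∫ x in Ioc (τ 0) (τ n), f x ∂μ ≤ ∑ j ∈ Finset.range n, v j * μ.real (Ioc (τ j) (τ (j + 1))) := by
  have hi' : ∀ s t, IntegrableOn f (Ioc s t) μ := fun s t =>
    (hi t).mono_set (Ioc_subset_Ioc_left bot_le)
  have hc : ∀ (c : ℝ) s t, IntegrableOn (fun _ => c) (Ioc s t) μ := fun c s t => by
    have := hμ s t
    exact integrable_const c
  rw [setIntegral_Ioc_eq_sum hτ n (hi' _ _)]
  refine ⟨Finset.sum_le_sum fun j _ => ?_, Finset.sum_le_sum fun j _ => ?_⟩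
  · have := setIntegral_mono_on (hc (u j) _ _) (hi' _ _) measurableSet_Ioc fun x hx => (huv j x hx).1
    rwa [setIntegral_const, smul_eq_mul, mul_comm] at this
  · have := setIntegral_mono_on (hi' _ _) (hc (v j) _ _) measurableSet_Ioc fun x hx => (huv j x hx).2
    rwa [setIntegral_const, smul_eq_mul, mul_comm (μ.real _)] at this

end Bounds

end

/-! ### Discretization along the nodes. -/

section

/-- The normalizing constant `∑_{k=1}^n q f (t_k)` of the discretization of `f`. -/
noncomputable def weightSum (f : ℝ≥0 → ℝ) (p q : ℝ≥0) (n : ℕ) : ℝ :=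
  ∑ j ∈ Finset.range n, f (node p q (j + 1)) * q

variable {Ω : Type*}

/-- The weighted sum `∑_{k=1}^n f (t_k) (S_{t_k} - S_{t_{k-1}})`. -/
def weightedSum (S : ℝ≥0 → Ω → ℝ) (f : ℝ≥0 → ℝ) (p q : ℝ≥0) (n : ℕ) (ω : Ω) : ℝ :=
  ∑ j ∈ Finset.range n, f (node p q (j + 1)) * (S (node p q (j + 1)) ω - S (node p q j) ω)

/-- The weighted sum `∑_{k=1}^n f (t_k) (S_{t_{k+1}} - S_{t_k})` with shifted increments. -/
def shiftedSum (S : ℝ≥0 → Ω → ℝ) (f : ℝ≥0 → ℝ) (p q : ℝ≥0) (n : ℕ) (ω : Ω) : ℝ :=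
  ∑ j ∈ Finset.range n, f (node p q (j + 1)) * (S (node p q (j + 2)) ω - S (node p q (j + 1)) ω)

/-- The step function equal to `f t_k` on `(t_{k-1}, t_k]` and to `0` on `[0, t_0]`. -/
noncomputable def discretization (f : ℝ≥0 → ℝ) (p q : ℝ≥0) : ℝ≥0 → ℝ :=
  (Ioi p).indicator (gridStep p q f)

lemma sum_Icc_one_eq_sum_range (g : ℕ → ℝ) (n : ℕ) :
    ∑ k ∈ Finset.Icc 1 n, g k = ∑ j ∈ Finset.range n, g (j + 1) := by
  induction n with
  | zero => simp
  | succ n ih => rw [Finset.sum_Icc_succ_top (by omega), ih, Finset.sum_range_succ]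

lemma discreteRatio_eq (S : ℝ≥0 → Ω → ℝ) (f : ℝ≥0 → ℝ) (p q : ℝ≥0) (n : ℕ) (ω : Ω) :
    discreteRatio S f p q n ω = weightedSum S f p q n ω / weightSum f p q n := by
  rw [discreteRatio, sum_Icc_one_eq_sum_range, sum_Icc_one_eq_sum_range]
  rfl

section Deterministic

variable {f : ℝ≥0 → ℝ} {p q : ℝ≥0} {μ : Measure ℝ≥0}

lemma node_zero (p q : ℝ≥0) : node p q 0 = p := by simp [node]

lemma measurable_discretization : Measurable (discretization f p q) :=
  (measurable_gridStep p q f).indicator measurableSet_Ioi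

lemma discretization_nonneg (h0 : ∀ x, 0 ≤ f x) (x : ℝ≥0) : 0 ≤ discretization f p q x :=
  indicator_nonneg (fun _ _ => h0 _) x

lemma setIntegral_discretization (hμ : ∀ a b, IsFiniteMeasure (μ.restrict (Ioc a b)))
    (hq : 0 < q) (n : ℕ) :
    ∫ x in Ioc 0 (node p q n), discretization f p q x ∂μ = ∑ j ∈ Finset.range n,
      f (node p q (j + 1)) * μ.real (Ioc (node p q j) (node p q (j + 1))) := by
  have h := setIntegral_gridStep hμ (p := p) hq f n
  simp only [smul_eq_mul, mul_comm (μ.real _)] at h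
  rw [discretization, setIntegral_indicator measurableSet_Ioi, ← h, node_zero]
  congr 2
  ext x
  simp only [mem_inter_iff, mem_Ioc, mem_Ioi]
  exact ⟨fun h => ⟨h.2, h.1.2⟩, fun h => ⟨⟨bot_le.trans_lt h.1, h.2⟩, h.1⟩⟩

lemma integrableOn_discretization (hμ : ∀ a b, IsFiniteMeasure (μ.restrict (Ioc a b)))
    (hq : 0 < q) (T : ℝ≥0) : IntegrableOn (discretization f p q) (Ioc 0 T) μ := by
  obtain ⟨n, hn⟩ := ((tendsto_node_atTop p hq).eventually (eventually_ge_atTop T)).exists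
  have h := integrableOn_gridStep hμ (p := p) hq f n
  rw [discretization, IntegrableOn, integrable_indicator_iff measurableSet_Ioi, IntegrableOn,
    Measure.restrict_restrict measurableSet_Ioi]
  refine h.mono_set fun x hx => ?_
  rw [node_zero]
  exact ⟨hx.1, hx.2.2.trans hn⟩

lemma lebesgue_real_node (p q : ℝ≥0) (j : ℕ) :
    lebesgue.real (Ioc (node p q j) (node p q (j + 1))) = q := by
  rw [lebesgue_real_Ioc (node_mono p q (Nat.le_succ j)), node_succ_sub]

lemma cumul_discretization (hq : 0 < q) (n : ℕ) :
    cumul (discretization f p q) (node p q n) = weightSum f p q n := by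
  rw [cumul, setIntegral_discretization isFiniteMeasure_lebesgue_restrict hq]
  simp only [lebesgue_real_node]
  rfl

lemma setIntegral_split (hi : ∀ T, IntegrableOn f (Ioc 0 T) μ) (n : ℕ) :
    ∫ x in Ioc 0 (node p q n), f x ∂μ
      = ∫ x in Ioc 0 p, f x ∂μ + ∫ x in Ioc (node p q 0) (node p q n), f x ∂μ := by
  have h := node_mono p q (Nat.zero_le n)
  rw [node_zero] at h ⊢
  rw [← setIntegral_union (Ioc_disjoint_Ioc_of_le le_rfl)
    measurableSet_Ioc (hi p) ((hi _).mono_set (Ioc_subset_Ioc_left bot_le)),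
    Ioc_union_Ioc_eq_Ioc (show 0 ≤ p from bot_le) h]

lemma node_bounds_of_monotone (hf : Monotone f) (j : ℕ) (x : ℝ≥0)
    (hx : x ∈ Ioc (node p q j) (node p q (j + 1))) :
    f (node p q j) ≤ f x ∧ f x ≤ f (node p q (j + 1)) :=
  ⟨hf hx.1.le, hf hx.2⟩

lemma node_bounds_of_antitone (hf : Antitone f) (j : ℕ) (x : ℝ≥0)
    (hx : x ∈ Ioc (node p q j) (node p q (j + 1))) :
    f (node p q (j + 1)) ≤ f x ∧ f x ≤ f (node p q j) :=
  ⟨hf hx.2, hf hx.1.le⟩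

lemma sum_node_add (f : ℝ≥0 → ℝ) (p q : ℝ≥0) (n : ℕ) :
    ∑ j ∈ Finset.range n, f (node p q j) * q + f (node p q n) * q
      = weightSum f p q n + f p * q := by
  rw [← Finset.sum_range_succ, Finset.sum_range_succ', node_zero, weightSum]

/-- The left and right Riemann sums of a monotonic function differ only by a first and a last term.
-/
lemma abs_cumul_sub_weightSum_le (hf : Monotone f ∨ Antitone f) (h0 : ∀ x, 0 ≤ f x) (n : ℕ) :
    |cumul f (node p q n) - weightSum f p q n| ≤ cumul f p + f p * q + f (node p q n) * q := by
  have hi := integrableOn_of_monotone_or_antitone hf h0 isFiniteMeasure_lebesgue_restrict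
  have hs := setIntegral_split (p := p) (q := q) hi n
  have h1 := sum_node_add f p q n
  have h2 : 0 ≤ cumul f p := integral_nonneg h0
  have h3 : 0 ≤ f p * q := mul_nonneg (h0 _) q.2
  have h4 : 0 ≤ f (node p q n) * q := mul_nonneg (h0 _) q.2
  rw [← cumul, ← cumul] at hs
  rcases hf with hf | hf
  · have hb := setIntegral_Ioc_bounds isFiniteMeasure_lebesgue_restrict hi (node_mono p q)
      (node_bounds_of_monotone hf) n
    simp only [lebesgue_real_node] at hb
    rw [← weightSum] at hb
    rw [abs_le]
    constructor <;> linarith [hb.1, hb.2]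
  · have hb := setIntegral_Ioc_bounds isFiniteMeasure_lebesgue_restrict hi (node_mono p q)
      (node_bounds_of_antitone hf) n
    simp only [lebesgue_real_node] at hb
    rw [← weightSum] at hb
    rw [abs_le]
    constructor <;> linarith [hb.1, hb.2]

lemma tendsto_weightSum_atTop (hf : Monotone f ∨ Antitone f) (h0 : ∀ x, 0 ≤ f x) (hq : 0 < q)
    (hdiv : Tendsto (cumul f) atTop atTop) : Tendsto (weightSum f p q) atTop atTop := by
  have hdivn := hdiv.comp (tendsto_node_atTop p hq)
  have hi := integrableOn_of_monotone_or_antitone hf h0 isFiniteMeasure_lebesgue_restrict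
  refine tendsto_atTop_mono (fun n => ?_)
    (tendsto_atTop_add_const_right _ (-(cumul f p + f p * q)) hdivn)
  have hs := setIntegral_split (p := p) (q := q) hi n
  rw [← cumul, ← cumul] at hs
  have h3 : 0 ≤ f p * q := mul_nonneg (h0 _) q.2
  have h4 : 0 ≤ f (node p q n) * q := mul_nonneg (h0 _) q.2
  have h1 := sum_node_add f p q n
  rw [Function.comp_apply]
  rcases hf with hf | hf
  · have hb := (setIntegral_Ioc_bounds isFiniteMeasure_lebesgue_restrict hi (node_mono p q)
      (node_bounds_of_monotone hf) n).2
    simp only [lebesgue_real_node] at hb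
    rw [← weightSum] at hb
    linarith
  · have hb := (setIntegral_Ioc_bounds isFiniteMeasure_lebesgue_restrict hi (node_mono p q)
      (node_bounds_of_antitone hf) n).2
    simp only [lebesgue_real_node] at hb
    linarith

lemma tendsto_cumul_div_weightSum (hf : Monotone f ∨ Antitone f) (h0 : ∀ x, 0 ≤ f x)
    (hA : Tendsto (weightSum f p q) atTop atTop)
    (hN : Tendsto (fun n => f (node p q n) * q / weightSum f p q n) atTop (𝓝 0)) :
    Tendsto (fun n => cumul f (node p q n) / weightSum f p q n) atTop (𝓝 1) := by
  rw [tendsto_iff_dist_tendsto_zero]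
  have hlim := (hA.const_div_atTop (cumul f p + f p * q)).add hN
  rw [add_zero] at hlim
  refine squeeze_zero' (Eventually.of_forall fun _ => dist_nonneg) ?_ hlim
  filter_upwards [hA.eventually (eventually_gt_atTop 0)] with n hn
  rw [Real.dist_eq, div_sub_one hn.ne', abs_div, abs_of_pos hn, ← add_div]
  gcongr
  exact abs_cumul_sub_weightSum_le hf h0 n

lemma weightSum_succ (f : ℝ≥0 → ℝ) (p q : ℝ≥0) (n : ℕ) :
    weightSum f p q (n + 1) = weightSum f p q n + f (node p q (n + 1)) * q :=
  Finset.sum_range_succ _ _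

lemma tendsto_weightSum_div_succ (hA : Tendsto (weightSum f p q) atTop atTop)
    (hN : Tendsto (fun n => f (node p q n) * q / weightSum f p q n) atTop (𝓝 0)) :
    Tendsto (fun n => weightSum f p q n / weightSum f p q (n + 1)) atTop (𝓝 1) := by
  have := ((tendsto_add_atTop_iff_nat 1).2 hN).const_sub 1
  rw [sub_zero] at this
  refine this.congr' ?_
  filter_upwards [((tendsto_add_atTop_iff_nat 1).2 hA).eventually (eventually_gt_atTop 0)] with n hn
  have h := weightSum_succ f p q n
  rw [one_sub_div (ne_of_gt hn)]
  congr 1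
  linarith

lemma tendsto_last_weight_of_antitone (hf : Antitone f) (h0 : ∀ x, 0 ≤ f x)
    (hA : Tendsto (weightSum f p q) atTop atTop) :
    Tendsto (fun n => f (node p q n) * q / weightSum f p q n) atTop (𝓝 0) := by
  refine squeeze_zero' ?_ ?_ (hA.const_div_atTop (f 0 * q))
  · filter_upwards [hA.eventually (eventually_gt_atTop 0)] with n hn
    exact div_nonneg (mul_nonneg (h0 _) q.2) hn.le
  · filter_upwards [hA.eventually (eventually_gt_atTop 0)] with n hn
    gcongr
    exact hf bot_le

lemma tendsto_last_weight_of_monotone (hf : Monotone f) (h0 : ∀ x, 0 ≤ f x) (hq : 0 < q)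
    (hdiv : Tendsto (cumul f) atTop atTop)
    (hL : Tendsto (fun n => cumul f (node p q n) / cumul f (node p q (n + 1))) atTop (𝓝 1)) :
    Tendsto (fun n => f (node p q n) * q / weightSum f p q n) atTop (𝓝 0) := by
  have hdivn := hdiv.comp (tendsto_node_atTop p hq)
  have hi := integrableOn_of_monotone_or_antitone (Or.inl hf) h0 isFiniteMeasure_lebesgue_restrict
  have hA := tendsto_weightSum_atTop (p := p) (Or.inl hf) h0 hq hdiv
  -- Monotonicity gives `f(t_n) q ≤ λ_{t_{n+1}} f - λ_{t_n} f`. The factor `2` comes from `weightSum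
  -- ≥ λ_{t_n} f - λ_p f ≥ λ_{t_n} f / 2` for large `n`.
  have hlim : Tendsto (fun n => 2 * ((cumul f (node p q n) / cumul f (node p q (n + 1)))⁻¹ - 1))
      atTop (𝓝 0) := by
    simpa using ((hL.inv₀ one_ne_zero).sub_const 1).const_mul 2
  have hhalf := hdivn.eventually (eventually_gt_atTop (2 * cumul f p))
  refine squeeze_zero' ?_ ?_ hlim
  · filter_upwards [hA.eventually (eventually_gt_atTop 0)] with n hn
    exact div_nonneg (mul_nonneg (h0 _) q.2) hn.le
  · filter_upwards [hA.eventually (eventually_gt_atTop 0), hhalf,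
      hdivn.eventually (eventually_gt_atTop 0)] with n hn hn2 hn3
    rw [Function.comp_apply] at hn2 hn3
    have hs := setIntegral_split (p := p) (q := q) hi n
    rw [← cumul, ← cumul] at hs
    have hb := (setIntegral_Ioc_bounds isFiniteMeasure_lebesgue_restrict hi (node_mono p q)
      (node_bounds_of_monotone hf) n).2
    simp only [lebesgue_real_node] at hb
    rw [← weightSum] at hb
    have hinc : f (node p q n) * q ≤ cumul f (node p q (n + 1)) - cumul f (node p q n) := by
      have hle := node_mono p q (Nat.le_succ n)
      rw [cumul_sub_cumul hi hle]
      have := setIntegral_mono_on (μ := lebesgue) (integrable_const (f (node p q n)))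
        ((hi _).mono_set (Ioc_subset_Ioc_left bot_le)) measurableSet_Ioc
        (fun x hx => (node_bounds_of_monotone (p := p) (q := q) hf n x hx).1)
      rwa [setIntegral_const, lebesgue_real_node, smul_eq_mul, mul_comm] at this
    rw [inv_div, div_sub_one hn3.ne', mul_div_assoc', div_le_div_iff₀ hn hn3]
    have h4 : 0 ≤ f (node p q n) * q := mul_nonneg (h0 _) q.2
    nlinarith

end Deterministic

lemma sum_node_eq (S : ℝ≥0 → Ω → ℝ) (f : ℝ≥0 → ℝ) (p q : ℝ≥0) (n : ℕ) (ω : Ω) :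
    ∑ j ∈ Finset.range (n + 1), f (node p q j) * (S (node p q (j + 1)) ω - S (node p q j) ω)
      = shiftedSum S f p q n ω + f p * (S (node p q 1) ω - S (node p q 0) ω) := by
  rw [Finset.sum_range_succ', shiftedSum, zero_add]
  congr 2
  rw [node_zero]

variable [MeasurableSpace Ω] {P : Measure Ω} {S : ℝ≥0 → Ω → ℝ}

namespace IsRegularGammaProcess

variable (hS : IsRegularGammaProcess S P) {f : ℝ≥0 → ℝ} {p q : ℝ≥0}
include hS

lemma pathMeasure_real_Ioc (ω : Ω) {a b : ℝ≥0} (hab : a ≤ b) :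
    (pathMeasure fun u => S u ω).real (Ioc a b) = S b ω - S a ω := by
  rw [Measure.real, hS.pathMeasure_Ioc, ENNReal.toReal_ofReal (sub_nonneg.2 (hS.mono ω hab))]

lemma pathMeasure_real_node (ω : Ω) (j : ℕ) :
    (pathMeasure fun u => S u ω).real (Ioc (node p q j) (node p q (j + 1)))
      = S (node p q (j + 1)) ω - S (node p q j) ω :=
  hS.pathMeasure_real_Ioc ω (node_mono p q (Nat.le_succ j))

lemma gammaIntegral_discretization (hq : 0 < q) (n : ℕ) (ω : Ω) :
    gammaIntegral S (discretization f p q) (node p q n) ω = weightedSum S f p q n ω := by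
  rw [gammaIntegral, setIntegral_discretization (hS.isFiniteMeasure_restrict ω) hq]
  simp only [hS.pathMeasure_real_node]
  rfl

lemma measurable_weightedSum (n : ℕ) : Measurable (weightedSum S f p q n) :=
  Finset.measurable_fun_sum _ fun _ _ => ((hS.measurable _).sub (hS.measurable _)).const_mul _

lemma measurable_shiftedSum (n : ℕ) : Measurable (shiftedSum S f p q n) :=
  Finset.measurable_fun_sum _ fun _ _ => ((hS.measurable _).sub (hS.measurable _)).const_mul _

lemma memLp_increment [IsProbabilityMeasure P] {a b : ℝ≥0} (hab : a ≤ b) (r : ℝ≥0) :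
    MemLp (fun ω => S b ω - S a ω) r P := by
  rcases hab.eq_or_lt with rfl | hab
  · simp
  · have hl := hS.law_increment a b hab
    have := memLp_id_gammaMeasure (sub_pos.2 (NNReal.coe_lt_coe.2 hab)) r
    rw [← hl.map_eq] at this
    exact (memLp_map_measure_iff this.1 hl.aemeasurable).1 this

lemma increment_nonneg (ω : Ω) (j : ℕ) : 0 ≤ S (node p q (j + 1)) ω - S (node p q j) ω :=
  sub_nonneg.2 (hS.mono ω (node_mono p q (Nat.le_succ j)))

lemma gammaIntegral_initial_le (hf : Monotone f ∨ Antitone f) (h0 : ∀ x, 0 ≤ f x) (ω : Ω) :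
    gammaIntegral S f p ω ≤ (f 0 + f p) * (S p ω - S 0 ω) := by
  have hi := integrableOn_of_monotone_or_antitone hf h0 (hS.isFiniteMeasure_restrict ω)
  have := hS.isFiniteMeasure_restrict ω 0 p
  have := setIntegral_mono_on (hi p) (integrable_const (f 0 + f p)) measurableSet_Ioc
    fun x hx => le_add_of_monotone_or_antitone hf h0 hx.2
  rwa [setIntegral_const, hS.pathMeasure_real_Ioc ω (show 0 ≤ p from bot_le), smul_eq_mul, mul_comm] at this

/-- Up to a fixed random variable, the Gamma integral of an increasing function lies between the
shifted and the unshifted weighted sum. -/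
lemma gammaIntegral_bounds_of_monotone (hf : Monotone f) (h0 : ∀ x, 0 ≤ f x) (n : ℕ) (ω : Ω) :
    shiftedSum S f p q n ω ≤ gammaIntegral S f (node p q (n + 1)) ω ∧
    gammaIntegral S f (node p q (n + 1)) ω ≤ weightedSum S f p q (n + 1) ω +
      ((f 0 + f p) * (S p ω - S 0 ω) + f p * (S (node p q 1) ω - S (node p q 0) ω)) := by
  have hi := integrableOn_of_monotone_or_antitone (Or.inl hf) h0 (hS.isFiniteMeasure_restrict ω)
  have hs := setIntegral_split (p := p) (q := q) hi (n + 1)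
  rw [← gammaIntegral, ← gammaIntegral] at hs
  have hb := setIntegral_Ioc_bounds (hS.isFiniteMeasure_restrict ω) hi (node_mono p q)
    (node_bounds_of_monotone hf) (n + 1)
  simp only [hS.pathMeasure_real_node] at hb
  rw [sum_node_eq] at hb
  rw [← weightedSum] at hb
  have h1 := hS.gammaIntegral_initial_le (p := p) (Or.inl hf) h0 ω
  have h2 : 0 ≤ gammaIntegral S f p ω := integral_nonneg h0
  have h3 : 0 ≤ f p * (S (node p q 1) ω - S (node p q 0) ω) :=
    mul_nonneg (h0 _) (hS.increment_nonneg ω 0)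
  constructor <;> linarith [hb.1, hb.2]

lemma gammaIntegral_bounds_of_antitone (hf : Antitone f) (h0 : ∀ x, 0 ≤ f x) (n : ℕ) (ω : Ω) :
    weightedSum S f p q (n + 1) ω ≤ gammaIntegral S f (node p q (n + 1)) ω ∧
    gammaIntegral S f (node p q (n + 1)) ω ≤ shiftedSum S f p q n ω +
      ((f 0 + f p) * (S p ω - S 0 ω) + f p * (S (node p q 1) ω - S (node p q 0) ω)) := by
  have hi := integrableOn_of_monotone_or_antitone (Or.inr hf) h0 (hS.isFiniteMeasure_restrict ω)
  have hs := setIntegral_split (p := p) (q := q) hi (n + 1)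
  rw [← gammaIntegral, ← gammaIntegral] at hs
  have hb := setIntegral_Ioc_bounds (hS.isFiniteMeasure_restrict ω) hi (node_mono p q)
    (node_bounds_of_antitone hf) (n + 1)
  simp only [hS.pathMeasure_real_node] at hb
  rw [sum_node_eq] at hb
  rw [← weightedSum] at hb
  have h1 := hS.gammaIntegral_initial_le (p := p) (Or.inr hf) h0 ω
  have h2 : 0 ≤ gammaIntegral S f p ω := integral_nonneg h0
  constructor <;> linarith [hb.1, hb.2]

variable [IsProbabilityMeasure P]

/-- Stationarity of the increments, obtained from `identDistrib_increments` with integrand `1` and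
nodes shifted by one. -/
lemma identDistrib_shiftedSum :
    IdentDistrib (fun ω n => weightedSum S f p q n ω) (fun ω n => shiftedSum S f p q n ω) P P := by
  have hmono : Monotone fun n => node p q (n + 1) := fun a b hab => node_mono p q (by omega)
  have h1 : ∀ T, IntegrableOn (fun _ : ℝ≥0 => (1 : ℝ)) (Ioc 0 T) lebesgue := fun T =>
    integrable_const (μ := lebesgue.restrict (Ioc 0 T)) 1
  have key := hS.identDistrib_increments (h := fun _ => 1) (h' := fun _ => 1)
    measurable_const measurable_const h1 h1 (node_mono p q) hmono fun j =>
      ⟨aemeasurable_const, aemeasurable_const, by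
        rw [Measure.map_const, Measure.map_const, Measure.restrict_apply_univ,
          Measure.restrict_apply_univ, lebesgue_Ioc, lebesgue_Ioc, node_succ_sub, node_succ_sub]⟩
  simp only [setIntegral_const, smul_eq_mul, mul_one, hS.pathMeasure_real_node] at key
  exact key.comp (u := fun (y : ℕ → ℝ) (n : ℕ) =>
    ∑ j ∈ Finset.range n, f (node p q (j + 1)) * y j) (by fun_prop)

/-- Applied with `u` the positive or the negative part. -/
lemma null_shiftedSum_iff {m : ConvMode} {u : ℝ → ℝ} (hu : Measurable u) (A : ℕ → ℝ) :
    m.Null P (fun n ω => u (weightedSum S f p q n ω / A n - 1)) atTop ↔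
      m.Null P (fun n ω => u (shiftedSum S f p q n ω / A n - 1)) atTop := by
  have key := (hS.identDistrib_shiftedSum (f := f) (p := p) (q := q)).comp
    (u := fun (y : ℕ → ℝ) (n : ℕ) => u (y n / A n - 1)) (by fun_prop)
  exact ⟨fun h => h.of_identDistrib key, fun h => h.of_identDistrib key.symm⟩

/-- The discrete ratio is the Gamma ratio, at the nodes, of the step function `discretization`; the
mass of its last interval is the last weight. -/
lemma tendsto_last_weight_of_discrete (h0 : ∀ x, 0 ≤ f x) (hq : 0 < q) {m : ConvMode}
    (hA : Tendsto (weightSum f p q) atTop atTop) (hR : DiscreteOrderlyDivergence m P S f p q) :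
    Tendsto (fun n => f (node p q n) * q / weightSum f p q n) atTop (𝓝 0) := by
  have hm : Measurable (discretization f p q) := measurable_discretization
  have hR' : OrderlyDivergenceAlong m P S (discretization f p q) p q := by
    rw [DiscreteOrderlyDivergence] at hR
    refine (ConvMode.TendstoOne.congr (ae_of_all _ fun ω n => ?_)).1 hR
    rw [gammaRatio, hS.gammaIntegral_discretization hq, cumul_discretization hq, discreteRatio_eq]
  have hdiv : Tendsto (fun n => cumul (discretization f p q) (node p q n)) atTop atTop := by
    simpa only [cumul_discretization hq] using hA
  have := hS.tendsto_increment_div hm (discretization_nonneg h0)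
    (integrableOn_discretization isFiniteMeasure_lebesgue_restrict hq) hdiv
    (hS.tendstoOne_inProbability hm hR')
  simp only [cumul_discretization hq, weightSum_succ f p q, add_sub_cancel_left] at this
  simp only [← weightSum_succ] at this
  exact (tendsto_add_atTop_iff_nat 1).1 this

/-- The integral of `f` bounds one part of the deviation of each of the two sums. Equality in law
brings both parts to the unshifted sum, and the converse reads the same bounds backwards. For
decreasing `f` the two sums exchange roles. -/
theorem orderlyDivergenceAlong_iff_discrete (hf : Monotone f ∨ Antitone f) (h0 : ∀ x, 0 ≤ f x)
    (hdiv : Tendsto (cumul f) atTop atTop) (m : ConvMode) (hq : 0 < q) :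
    OrderlyDivergenceAlong m P S f p q ↔ DiscreteOrderlyDivergence m P S f p q := by
  have hm := measurable_of_monotone_or_antitone hf
  have hi := integrableOn_of_monotone_or_antitone hf h0 isFiniteMeasure_lebesgue_restrict
  have hdivn := hdiv.comp (tendsto_node_atTop p hq)
  have hA := tendsto_weightSum_atTop (p := p) hf h0 hq hdiv
  -- If the last weight is not negligible, both sides of the equivalence are false.
  by_cases hN : Tendsto (fun n => f (node p q n) * q / weightSum f p q n) atTop (𝓝 0)
  swap
  · refine ⟨fun h => absurd ?_ hN,
      fun h => absurd (hS.tendsto_last_weight_of_discrete h0 hq hA h) hN⟩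
    rcases hf with hf | hf
    · exact tendsto_last_weight_of_monotone hf h0 hq hdiv
        (hS.tendsto_cumul_ratio hm h0 hi hdivn (hS.tendstoOne_inProbability hm h))
    · exact tendsto_last_weight_of_antitone hf h0 hA
  have hA' := (tendsto_add_atTop_iff_nat 1).2 hA
  have hℓ := (tendsto_add_atTop_iff_nat 1).2 hdivn
  have hℓ0 := hℓ.eventually (eventually_gt_atTop 0)
  have hβ : Tendsto (fun n => weightSum f p q (n + 1) / cumul f (node p q (n + 1))) atTop (𝓝 1) := by
    have := (tendsto_cumul_div_weightSum hf h0 hA hN).inv₀ one_ne_zero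
    simp only [inv_div, inv_one] at this
    exact (tendsto_add_atTop_iff_nat 1).2 this
  -- The shifted sum with `n` weights already extends to time `t_{n+1}`, so its normalizer
  -- `weightSum n` is compared with `λ` at `t_{n+1}`.
  have hα : Tendsto (fun n => weightSum f p q n / cumul f (node p q (n + 1))) atTop (𝓝 1) := by
    have := (tendsto_weightSum_div_succ hA hN).mul hβ
    rw [one_mul] at this
    refine this.congr' ?_
    filter_upwards [hA'.eventually (eventually_gt_atTop 0)] with n hn
    rw [div_mul_div_cancel₀ (ne_of_gt hn)]
  have hα0 := hA.eventually (eventually_gt_atTop 0)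
  have hβ0 := hA'.eventually (eventually_gt_atTop 0)
  -- Bounds the contribution of `(0, p]` and the term with weight `f p` from the first interval.
  let Y : Ω → ℝ := fun ω =>
    (f 0 + f p) * (S p ω - S 0 ω) + f p * (S (node p q 1) ω - S (node p q 0) ω)
  have mY : Measurable Y := (((hS.measurable _).sub (hS.measurable _)).const_mul _).add
    (((hS.measurable _).sub (hS.measurable _)).const_mul _)
  have hY : ∀ r : ℝ≥0, MemLp Y r P := fun r =>
    ((hS.memLp_increment bot_le r).const_mul _).add
      ((hS.memLp_increment (node_mono p q (Nat.zero_le 1)) r).const_mul _)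
  have mσ : ∀ n, Measurable (gammaIntegral S f (node p q (n + 1))) := fun n =>
    hS.measurable_gammaIntegral hm _
  have mD : ∀ n, Measurable (weightedSum S f p q (n + 1)) := fun n => hS.measurable_weightedSum _
  have mE : ∀ n, Measurable (shiftedSum S f p q n) := fun n => hS.measurable_shiftedSum _
  have mmax : Measurable fun x : ℝ => max x 0 := by fun_prop
  have mmin : Measurable fun x : ℝ => min x 0 := by fun_prop
  have hmaxE := hS.null_shiftedSum_iff (f := f) (p := p) (q := q) (m := m) mmax (weightSum f p q)
  have hminE := hS.null_shiftedSum_iff (f := f) (p := p) (q := q) (m := m) mmin (weightSum f p q)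
  have hmaxD := ConvMode.null_succ_iff (P := P) (m := m)
    (Z := fun n ω => max (weightedSum S f p q n ω / weightSum f p q n - 1) 0)
  have hminD := ConvMode.null_succ_iff (P := P) (m := m)
    (Z := fun n ω => min (weightedSum S f p q n ω / weightSum f p q n - 1) 0)
  have hD : DiscreteOrderlyDivergence m P S f p q ↔ _ :=
    (ConvMode.TendstoOne.congr (ae_of_all _ fun ω n => discreteRatio_eq S f p q n ω)).trans
    (ConvMode.tendstoOne_iff_null.trans (null_iff_max_min fun n =>
      ((hS.measurable_weightedSum (f := f) (p := p) (q := q) n).div_const _).sub_const 1))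
  have hσ : OrderlyDivergenceAlong m P S f p q ↔ m.Null P
      (fun n ω => gammaIntegral S f (node p q (n + 1)) ω / cumul f (node p q (n + 1)) - 1) atTop :=
    ConvMode.tendstoOne_iff_null.trans ConvMode.null_succ_iff.symm
  rw [hσ, hD]
  rcases hf with hf | hf
  · have hlo := fun n ω => (hS.gammaIntegral_bounds_of_monotone (p := p) (q := q) hf h0 n ω).1
    have hup := fun n ω => (hS.gammaIntegral_bounds_of_monotone (p := p) (q := q) hf h0 n ω).2
    constructor
    · intro h
      exact ⟨hmaxE.2 (null_max_of_le hlo mσ hα hα0 hℓ0 h),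
        hminD.1 (null_min_of_le hup mσ mY hY hβ hA' hℓ0 h)⟩
    · rintro ⟨h1, h2⟩
      exact null_of_squeeze hlo hup mE mD mY hY hℓ hα hβ hα0 hβ0 (hminE.1 h2) (hmaxD.2 h1)
  · have hlo := fun n ω => (hS.gammaIntegral_bounds_of_antitone (p := p) (q := q) hf h0 n ω).1
    have hup := fun n ω => (hS.gammaIntegral_bounds_of_antitone (p := p) (q := q) hf h0 n ω).2
    constructor
    · intro h
      exact ⟨hmaxD.1 (null_max_of_le hlo mσ hβ hβ0 hℓ0 h),
        hminE.2 (null_min_of_le hup mσ mY hY hα hA hℓ0 h)⟩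
    · rintro ⟨h1, h2⟩
      exact null_of_squeeze hlo hup mD mE mY hY hℓ hβ hα hβ0 hα0 (hminD.2 h2) (hmaxE.1 h1)

end IsRegularGammaProcess

end

/-! ### Rearrangements between the nodes. -/

section

/-- The nodes preceded by the origin. -/
def extendedNode (p q : ℝ≥0) : ℕ → ℝ≥0
  | 0 => 0
  | n + 1 => node p q n

lemma extendedNode_mono (p q : ℝ≥0) : Monotone (extendedNode p q) := by
  refine monotone_nat_of_le_succ fun n => ?_
  cases n with
  | zero => exact bot_le
  | succ n => exact node_mono p q (Nat.le_succ n)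

lemma exists_le_extendedNode (p : ℝ≥0) {q : ℝ≥0} (hq : 0 < q) (T : ℝ≥0) :
    ∃ n, T ≤ extendedNode p q n := by
  obtain ⟨n, hn⟩ := ((tendsto_node_atTop p hq).eventually (eventually_ge_atTop T)).exists
  exact ⟨n + 1, hn⟩

lemma iUnion_Ioc_extendedNode (p : ℝ≥0) {q : ℝ≥0} (hq : 0 < q) :
    ⋃ j, Ioc (extendedNode p q j) (extendedNode p q (j + 1)) = Ioi 0 := by
  refine Subset.antisymm (iUnion_subset fun j x hx => bot_le.trans_lt hx.1) fun x hx => ?_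
  classical
  have hex := exists_le_extendedNode p hq x
  rw [mem_iUnion]
  have h0 : Nat.find hex ≠ 0 := fun h => by
    have := Nat.find_spec hex
    rw [h] at this
    exact absurd hx (not_lt.2 this)
  obtain ⟨j, hj⟩ := Nat.exists_eq_succ_of_ne_zero h0
  refine ⟨j, not_le.1 (Nat.find_min hex (by omega)), ?_⟩
  have := Nat.find_spec hex
  rwa [hj] at this

lemma ae_restrict_Ioc_of_ae_restrict_Ioi {g g' : ℝ≥0 → ℝ} (h : ∀ᵐ x ∂lebesgue.restrict (Ioi 0), g x = g' x)
    (T : ℝ≥0) : ∀ᵐ x ∂lebesgue.restrict (Ioc 0 T), g x = g' x :=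
  ae_restrict_of_ae_restrict_of_subset (fun _ hx => hx.1) h

section Rearrangement

variable {f g : ℝ≥0 → ℝ} {p q : ℝ≥0}

lemma IsRearrangementBetweenNodes.identDistrib (h : IsRearrangementBetweenNodes g f p q) (j : ℕ) :
    IdentDistrib g f (lebesgue.restrict (Ioc (extendedNode p q j) (extendedNode p q (j + 1))))
      (lebesgue.restrict (Ioc (extendedNode p q j) (extendedNode p q (j + 1)))) := by
  cases j with
  | zero => exact h.1
  | succ n => exact h.2 n

/-- Equimeasurability gives `g` measurability and nonnegativity only almost everywhere. A good
representative loses nothing, since `dS` almost surely ignores the exceptional null set. -/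
lemma IsRearrangementBetweenNodes.exists_measurable (hq : 0 < q)
    (h : IsRearrangementBetweenNodes g f p q) (h0 : ∀ x, 0 ≤ f x) :
    ∃ g' : ℝ≥0 → ℝ, Measurable g' ∧ (∀ x, 0 ≤ g' x) ∧
      (∀ᵐ x ∂lebesgue.restrict (Ioi 0), g x = g' x) ∧ IsRearrangementBetweenNodes g' f p q := by
  have hU := iUnion_Ioc_extendedNode p hq
  have hg : AEMeasurable g (lebesgue.restrict (Ioi 0)) := by
    rw [← hU, aemeasurable_iUnion_iff]
    exact fun j => (h.identDistrib j).aemeasurable_fst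
  have hnn : ∀ᵐ x ∂lebesgue.restrict (Ioi 0), 0 ≤ g x := by
    rw [← hU, ae_restrict_iUnion_iff]
    exact fun j => (h.identDistrib j).symm.ae_snd (p := fun y => 0 ≤ y) measurableSet_Ici
      (ae_of_all _ h0)
  have heq : ∀ᵐ x ∂lebesgue.restrict (Ioi 0), g x = max (hg.mk g x) 0 := by
    filter_upwards [hnn, hg.ae_eq_mk] with x hx hx'
    rw [← hx', max_eq_left hx]
  have hid : ∀ {a b : ℝ≥0}, IdentDistrib g f (lebesgue.restrict (Ioc a b))
      (lebesgue.restrict (Ioc a b)) → IdentDistrib (fun x => max (hg.mk g x) 0) f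
      (lebesgue.restrict (Ioc a b)) (lebesgue.restrict (Ioc a b)) := by
    intro a b hab
    refine (IdentDistrib.of_ae_eq hab.aemeasurable_fst ?_).symm.trans hab
    exact ae_restrict_of_ae_restrict_of_subset (fun x hx => bot_le.trans_lt hx.1) heq
  exact ⟨fun x => max (hg.mk g x) 0, hg.measurable_mk.max measurable_const,
    fun x => le_max_right _ _, heq, hid h.1, fun k => hid (h.2 k)⟩

lemma IsRearrangementBetweenNodes.integrableOn (hq : 0 < q)
    (h : IsRearrangementBetweenNodes g f p q) (hi : ∀ T, IntegrableOn f (Ioc 0 T) lebesgue)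
    (T : ℝ≥0) : IntegrableOn g (Ioc 0 T) lebesgue := by
  obtain ⟨n, hn⟩ := exists_le_extendedNode p hq T
  refine IntegrableOn.mono_set ?_ (Ioc_subset_Ioc_right hn)
  clear hn
  induction n with
  | zero => simp [extendedNode]
  | succ n ih =>
    rw [← Ioc_union_Ioc_eq_Ioc (show 0 ≤ extendedNode p q n from bot_le)
      (extendedNode_mono p q (Nat.le_succ n))]
    exact ih.union ((h.identDistrib n).integrable_iff.2
      ((hi _).mono_set (Ioc_subset_Ioc_left bot_le)))

lemma IsRearrangementBetweenNodes.cumul_eq (hq : 0 < q)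
    (h : IsRearrangementBetweenNodes g f p q) (hi : ∀ T, IntegrableOn f (Ioc 0 T) lebesgue)
    (n : ℕ) : cumul g (node p q n) = cumul f (node p q n) := by
  have e1 := setIntegral_Ioc_eq_sum (extendedNode_mono p q) (n + 1) (h.integrableOn hq hi _)
  have e2 := setIntegral_Ioc_eq_sum (extendedNode_mono p q) (n + 1) (hi _)
  refine e1.trans (Eq.trans ?_ e2.symm)
  exact Finset.sum_congr rfl fun j _ => (h.identDistrib j).integral_eq

end Rearrangement

variable {Ω : Type*} [MeasurableSpace Ω] {P : Measure Ω} {S : ℝ≥0 → Ω → ℝ}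

namespace IsRegularGammaProcess

variable (hS : IsRegularGammaProcess S P) {f g : ℝ≥0 → ℝ} {p q : ℝ≥0}
include hS

/-- Integer horizons provide one null set valid for all `t`. -/
lemma ae_gammaRatio_eq {g' : ℝ≥0 → ℝ} (h : ∀ᵐ x ∂lebesgue.restrict (Ioi 0), g x = g' x) :
    ∀ᵐ ω ∂P, ∀ t, gammaRatio S g t ω = gammaRatio S g' t ω := by
  filter_upwards [ae_all_iff.2 fun n : ℕ => hS.ae_ae_restrict (ae_restrict_Ioc_of_ae_restrict_Ioi h n)]
    with ω hω t
  obtain ⟨n, hn⟩ := exists_nat_ge t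
  rw [gammaRatio, gammaRatio, cumul, cumul, integral_congr_ae (ae_restrict_Ioc_of_ae_restrict_Ioi h t),
    gammaIntegral, gammaIntegral,
    integral_congr_ae (ae_restrict_of_ae_restrict_of_subset (Ioc_subset_Ioc_right hn) (hω n))]

variable [IsProbabilityMeasure P]

lemma orderlyDivergenceAlong_rearrangement (hq : 0 < q) (hf : Measurable f) (hg : Measurable g)
    (hi : ∀ T, IntegrableOn f (Ioc 0 T) lebesgue) (h : IsRearrangementBetweenNodes g f p q)
    (m : ConvMode) : OrderlyDivergenceAlong m P S f p q ↔ OrderlyDivergenceAlong m P S g p q := by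
  have hτ := extendedNode_mono p q
  have key := (hS.identDistrib_integrals hg hf (h.integrableOn hq hi) hi hτ hτ h.identDistrib).comp
    -- The index `n + 1` appears because `extendedNode` puts the origin before `t_0`.
    (u := fun (y : ℕ → ℝ) (n : ℕ) => y (n + 1) / cumul f (node p q n) - 1) (by fun_prop)
  rw [OrderlyDivergenceAlong, OrderlyDivergenceAlong, ConvMode.tendstoOne_iff_null,
    ConvMode.tendstoOne_iff_null]
  simp only [gammaRatio, h.cumul_eq hq hi]
  exact ⟨fun h => h.of_identDistrib key.symm, fun h => h.of_identDistrib key⟩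

/-- Between the nodes the two ratios are not comparable, so both functions are reduced to the nodes.
There the normalizers coincide and the sequences of integrals have the same law. -/
theorem orderlyDivergence_rearrangement (hq : 0 < q) (hf : Measurable f) (h0 : ∀ x, 0 ≤ f x)
    (hi : ∀ T, IntegrableOn f (Ioc 0 T) lebesgue) (hdiv : Tendsto (cumul f) atTop atTop)
    (h : IsRearrangementBetweenNodes g f p q) (m : ConvMode) :
    OrderlyDivergence m P S f ↔ OrderlyDivergence m P S g := by
  obtain ⟨g', hg', h0', heq, h'⟩ := h.exists_measurable hq h0
  have hi' := h'.integrableOn hq hi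
  have hdiv' : Tendsto (cumul g') atTop atTop := by
    -- `cumul g'` is increasing and coincides with `cumul f` at the nodes.
    refine tendsto_atTop_of_monotone_of_subseq (cumul_mono h0' hi') (φ := node p q) (l := atTop) ?_
    exact (hdiv.comp (tendsto_node_atTop p hq)).congr fun n => (h'.cumul_eq hq hi n).symm
  rw [hS.orderlyDivergence_iff_along hf h0 hi p hq hdiv,
    hS.orderlyDivergenceAlong_rearrangement hq hf hg' hi h' m,
    ← hS.orderlyDivergence_iff_along hg' h0' hi' p hq hdiv']
  exact ConvMode.TendstoOne.congr ((hS.ae_gammaRatio_eq heq).mono fun ω hω t => (hω t).symm)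

end IsRegularGammaProcess

end

theorem mainTheorem8 {Ω : Type*} [MeasurableSpace Ω] (P : Measure Ω) [IsProbabilityMeasure P]
    (S : ℝ≥0 → Ω → ℝ) (hS : IsGammaProcess S P)
    (f : ℝ≥0 → ℝ) (hf_nonneg : ∀ x, 0 ≤ f x) (hf_mono : Monotone f ∨ Antitone f)
    (hf_div : Tendsto (cumul f) atTop atTop) (m : ConvMode) :
    (∀ p q : ℝ≥0, 0 < q →
      (OrderlyDivergence m P S f ↔ OrderlyDivergenceAlong m P S f p q) ∧
      (OrderlyDivergence m P S f ↔ DiscreteOrderlyDivergence m P S f p q)) ∧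
    (∀ p q : ℝ≥0, 0 < q → ∀ g : ℝ≥0 → ℝ, IsRearrangementBetweenNodes g f p q →
      (OrderlyDivergence m P S f ↔ OrderlyDivergence m P S g)) := by
  obtain ⟨S', hS', heq⟩ := hS.exists_regular
  have hratio : ∀ g : ℝ≥0 → ℝ, ∀ᵐ ω ∂P, ∀ t, gammaRatio S g t ω = gammaRatio S' g t ω := by
    intro g
    filter_upwards [heq] with ω hω t
    simp only [gammaRatio, gammaIntegral, hω]
  have hOD : ∀ g, OrderlyDivergence m P S g ↔ OrderlyDivergence m P S' g := fun g =>
    ConvMode.TendstoOne.congr (hratio g)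
  have hOA : ∀ p q, OrderlyDivergenceAlong m P S f p q ↔ OrderlyDivergenceAlong m P S' f p q :=
    fun p q => ConvMode.TendstoOne.congr ((hratio f).mono fun ω hω n => hω _)
  have hDD : ∀ p q, DiscreteOrderlyDivergence m P S f p q ↔
      DiscreteOrderlyDivergence m P S' f p q := fun p q =>
    ConvMode.TendstoOne.congr (heq.mono fun ω hω n => by simp only [discreteRatio, hω])
  have hm := measurable_of_monotone_or_antitone hf_mono
  have hi := integrableOn_of_monotone_or_antitone hf_mono hf_nonneg
    isFiniteMeasure_lebesgue_restrict
  refine ⟨fun p q hq => ?_, fun p q hq g hg => ?_⟩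
  · have h1 := hS'.orderlyDivergence_iff_along hm hf_nonneg hi (m := m) p hq hf_div
    rw [hOD, hOA, hDD]
    exact ⟨h1, h1.trans (hS'.orderlyDivergenceAlong_iff_discrete hf_mono hf_nonneg hf_div m hq)⟩
  · rw [hOD, hOD]
    exact hS'.orderlyDivergence_rearrangement hq hm hf_nonneg hi hf_div hg m
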